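/- Let $V=\mathbb F_2^3\times\mathbb F_2^3$ with the symplectic form $\omega((\lambda,\mu),(\lambda^*,\mu^*))=\lambda\cdot\mu^*+\lambda^*\cdot\mu$, and let $Q(V)$ be the set of quadratic forms $q:V\to\mathbb F_2$ with $q(v+w)=q(v)+q(w)+\omega(v,w)$. Each $q\in Q(V)$ can be written uniquely as $q(\lambda,\mu)=\lambda\cdot\mu+\lambda\cdot q'+q''\cdot\mu$; let $(q)=(q',q'')\in\mathbb Z^3\times\mathbb Z^3$ be the characteristic whose entries are the representatives in $\{0,1\}$ of these coordinates, and for several forms let $(\sum_i q_i):=\sum_i (q_i)$, a sum in $\mathbb Z^3\times\mathbb Z^3$ that is not reduced modulo $2$. The form $q$ is odd if its Arf invariant $a(q)=q'\cdot q''$ is $1\in\mathbb F_2$. A collection of at least three forms in $Q(V)$ is azygetic if $a(q_i)+a(q_j)+a(q_k)+a(q_i+q_j+q_k)=1$ for any three of its members, and an Aronhold system is an azygetic collection of seven odd forms. For $\tau$ in the Siegel upper half-space $\mathfrak S_3$ (complex symmetric $3\times 3$ matrices with positive definite imaginary part), $z\in\mathbb C^3$ and $m=(m',m'')\in\mathbb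 Z^3\times\mathbb Z^3$, put $\mathbf e(x)=\exp(\pi i x)$, $$\theta_m(\tau,z)=\sum_{n\in\mathbb Z^3}\mathbf e\Big[{}^t\big(n+\tfrac{m'}2\big)\,\tau\,\big(n+\tfrac{m'}2\big)+2\big(n+\tfrac{m'}2\big)\cdot\big(z+\tfrac{m''}2\big)\Big],$$ $\theta(m)=\theta_m(\tau,0)$, and let $D[p,q,r]$ be the determinant of the $3\times3$ matrix whose rows are the gradients with respect to $z$, at $z=0$, of $\theta_{(p)}(\tau,z)$, $\theta_{(q)}(\tau,z)$, $\theta_{(r)}(\tau,z)$. **Proposition.** Let $\{q_1,q_2,q_3,q_4\}$ be an azygetic $4$-tuple of odd forms in $Q(V)$. Then there are exactly two triples $\{q_5,q_6,q_7\}$ which complete it to an Aronhold system $\{q_1,\dots,q_7\}$. For each such triple, in any order, and every $\tau\in\mathfrak S_3$, $$D[q_4,q_2,q_3]\;\theta(q_5+q_6+q_4)\,\theta(q_5+q_7+q_4)\,\theta(q_6+q_7+q_4)=-\mathbf e\big((q_5+q_6+q_7)'\cdot(q_1+q_4)''\big)\;D[q_1,q_2,q_3]\;\theta(q_5+q_6+q_1)\,\theta(q_5+q_7+q_1)\,\theta(q_6+q_7+q_1),$$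 and hence, whenever the denominators do not vanish at $\tau$, $$\frac{D[q_4,q_2,q_3]}{D[q_1,q_2,q_3]}=-\mathbf e\big((q_5+q_6+q_7)'\cdot(q_1+q_4)''\big)\,\frac{\theta(q_5+q_6+q_1)\,\theta(q_5+q_7+q_1)\,\theta(q_6+q_7+q_1)}{\theta(q_5+q_6+q_4)\,\theta(q_5+q_7+q_4)\,\theta(q_6+q_7+q_4)}.$$ -/

import Mathlib

noncomputable section

/-- The symplectic space `𝔽₂^{2g}`; the vector `(l, u)` is `∑ lᵢ eᵢ + ∑ uᵢ fᵢ` in a fixed symplectic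
basis `e₁, …, e_g, f₁, …, f_g`. -/
abbrev SympSpace (g : ℕ) : Type := (Fin g → ZMod 2) × (Fin g → ZMod 2)

/-- The standard symplectic form on `𝔽₂^{2g}`. -/
def sympForm {g : ℕ} (v w : SympSpace g) : ZMod 2 := v.1 ⬝ᵥ w.2 + w.1 ⬝ᵥ v.2

/-- The basis vector `eᵢ`. -/
def basisE {g : ℕ} (i : Fin g) : SympSpace g := (Pi.single i 1, 0)

/-- The basis vector `fᵢ`. -/
def basisF {g : ℕ} (i : Fin g) : SympSpace g := (0, Pi.single i 1)

/-- `Q(V)`: the quadratic forms `q` with `q (v + w) = q v + q w + ω(v, w)`. -/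
abbrev SympQuadForm (g : ℕ) : Type :=
  {q : QuadraticForm (ZMod 2) (SympSpace g) // ∀ v w, QuadraticMap.polar q v w = sympForm v w}

/-- The Arf invariant `∑ᵢ q(eᵢ) q(fᵢ)`. -/
def arf {g : ℕ} (q : QuadraticForm (ZMod 2) (SympSpace g)) : ZMod 2 :=
  ∑ i, q (basisE i) * q (basisF i)

/-- Odd quadratic forms: Arf invariant `1`. -/
def IsOddForm {g : ℕ} (q : SympQuadForm g) : Prop := arf q.1 = 1

/-- A triple is azygetic if `a(q₁) + a(q₂) + a(q₃) + a(q₁ + q₂ + q₃) = 1`. -/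
def IsAzygeticTriple {g : ℕ} (p q r : SympQuadForm g) : Prop :=
  arf p.1 + arf q.1 + arf r.1 + arf (p.1 + q.1 + r.1) = 1

/-- A family is azygetic if each of its sub-triples is. (A triple with a repeated entry is never
azygetic, so an azygetic family of at least three forms has distinct members.) -/
def IsAzygetic {g n : ℕ} (q : Fin n → SympQuadForm g) : Prop :=
  ∀ i j k, i ≠ j → i ≠ k → j ≠ k → IsAzygeticTriple (q i) (q j) (q k)

/-- An Aronhold system in genus `3`: seven odd quadratic forms all of whose sub-triples are
azygetic. -/
def IsAronhold (q : Fin 7 → SympQuadForm 3) : Prop :=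
  (∀ i, IsOddForm (q i)) ∧ IsAzygetic q

/-- Integral theta characteristics `m = (m', m'')`. -/
abbrev ThetaChar (g : ℕ) : Type := (Fin g → ℤ) × (Fin g → ℤ)

/-- The coordinates `(q', q'')` of `q`, lifted to integers in `{0, 1}`. They are determined by
`q (l, u) = l · u + l · q' + q'' · u`, that is, by `q'ᵢ = q(eᵢ)` and `q''ᵢ = q(fᵢ)`. -/
def SympQuadForm.char {g : ℕ} (q : SympQuadForm g) : ThetaChar g :=
  (fun i => ((q.1 (basisE i)).val : ℤ), fun i => ((q.1 (basisF i)).val : ℤ))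

/-- The Siegel upper half-space: complex symmetric matrices with positive definite imaginary
part. -/
def siegelUpperHalfSpace (g : ℕ) : Set (Matrix (Fin g) (Fin g) ℂ) :=
  {τ | τ.IsSymm ∧ (τ.map Complex.im).PosDef}

/-- `𝐞(x) = exp(π i x)`. -/
def expPiI (x : ℂ) : ℂ := Complex.exp (Real.pi * Complex.I * x)

/-- The Riemann theta function `θ_m(τ, z)` of level `2`. -/
def riemannTheta {g : ℕ} (m : ThetaChar g) (τ : Matrix (Fin g) (Fin g) ℂ) (z : Fin g → ℂ) : ℂ :=
  ∑' n : Fin g → ℤ,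
    let x : Fin g → ℂ := fun i => (n i : ℂ) + (m.1 i : ℂ) / 2
    let y : Fin g → ℂ := fun i => z i + (m.2 i : ℂ) / 2
    expPiI (x ⬝ᵥ τ.mulVec x + 2 * (x ⬝ᵥ y))

/-- The theta constant `θ_m(τ) = θ_m(τ, 0)`. -/
def thetaConst {g : ℕ} (m : ThetaChar g) (τ : Matrix (Fin g) (Fin g) ℂ) : ℂ :=
  riemannTheta m τ 0

/-- The gradient of `θ_m(τ, z)` in `z` at `z = 0`. -/
def thetaGrad {g : ℕ} (m : ThetaChar g) (τ : Matrix (Fin g) (Fin g) ℂ) (j : Fin g) : ℂ :=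
  deriv (fun t : ℂ => riemannTheta m τ (Pi.single j t)) 0

/-- The Jacobian determinant `D[q₁, …, q_g](τ)`. -/
def thetaJac {g : ℕ} (q : Fin g → SympQuadForm g) (τ : Matrix (Fin g) (Fin g) ℂ) : ℂ :=
  (Matrix.of fun i j => thetaGrad (q i).char τ j).det

end

open Matrix

/-! The identity comes from a linear relation among the gradients at `q₁, …, q₄`, obtained from
Riemann's theta formula. Take `k₁ = q₁` and `k₂, k₃, k₄ = q₁ + (two of q₅, q₆, q₇)`. On the other
side of the formula stand `2q₁ + q₅ + q₆ + q₇` and `-q₇, -q₆, -q₅`. Theta functions with odd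
characteristic vanish at `z = 0`, so a product with two of them as factors has zero derivative
there. Differentiating gives a signed sum over `a ∈ V` of `grad θ(k₁+a) θ(k₂+a) θ(k₃+a) θ(k₄+a)`
equal to `0` (`sum_gradTerm_eq_zero`).

The same holds after adding `c = q₁ + q₂ + q₃ + q₄` to every `hᵢ`, because `q₅ + c` and `q₆ + c` are
again odd. The shift multiplies the term at `a` by `(-1)^ω(a,c)`, so adding the two relations leaves
only the terms with `a ⊥ c` (`sum_gradTerm_orthogonal_eq_zero`). By parity the only terms that can
still be nonzero are those with `q₁ + a ∈ {q₁, q₂, q₃, q₄}` (`IsAronhold.thetaGrad_relation`).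
Taking the determinant with the gradients at `q₂, q₃` eliminates two of these four and leaves the
asserted identity (`IsAronhold.thetaJac_mul`).

For the count, identify `Q(V)` with `𝔽₂⁶` by coordinates and put `m` for `q₁`. Oddness of `m + u`
becomes `arfDiff m u = 0`, where `arfDiff m` is a quadratic form with polar form `ω`, and azygetic
means that the differences `uᵢ` have pairwise product `1`. An Aronhold system is thus a special
basis of `𝔽₂⁶`, and `u₀, u₁, u₂` always extend to one (`exists_isAzygeticBasis`). The candidates for
a further member are `u₃, u₄, u₅` and their translates by `u₀ + u₁ + u₂`. Joining candidates with
product `1` gives a triangular prism, whose two triangles are the two completions. -/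

/-! ### Theta series: signs, convergence, differentiability. -/

/-- The point `n + m'/2` of a shifted lattice. -/
noncomputable def charPoint {g : ℕ} (m : ThetaChar g) (n : Fin g → ℤ) : Fin g → ℂ :=
  fun i => (n i : ℂ) + (m.1 i : ℂ) / 2

/-- The argument `z + m''/2`. -/
noncomputable def charArg {g : ℕ} (m : ThetaChar g) (z : Fin g → ℂ) : Fin g → ℂ :=
  fun i => z i + (m.2 i : ℂ) / 2

/-- The exponent of a term of the theta series. -/
noncomputable def thetaExponent {g : ℕ} (τ : Matrix (Fin g) (Fin g) ℂ) (x y : Fin g → ℂ) : ℂ :=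
  x ⬝ᵥ τ.mulVec x + 2 * (x ⬝ᵥ y)

/-- A term of the theta series. -/
noncomputable def thetaTerm {g : ℕ} (m : ThetaChar g) (τ : Matrix (Fin g) (Fin g) ℂ) (z : Fin g → ℂ)
    (n : Fin g → ℤ) : ℂ :=
  expPiI (thetaExponent τ (charPoint m n) (charArg m z))

theorem riemannTheta_eq_tsum {g : ℕ} (m : ThetaChar g) (τ : Matrix (Fin g) (Fin g) ℂ)
    (z : Fin g → ℂ) : riemannTheta m τ z = ∑' n, thetaTerm m τ z n := rfl

theorem expPiI_add (x y : ℂ) : expPiI (x + y) = expPiI x * expPiI y := by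
  simp [expPiI, mul_add, Complex.exp_add]

theorem expPiI_zero : expPiI 0 = 1 := by simp [expPiI]

theorem expPiI_two_mul_int (n : ℤ) : expPiI (2 * n) = 1 := by
  rw [expPiI, Complex.exp_eq_one_iff]
  exact ⟨n, by ring⟩

theorem expPiI_int_add_two_mul (n k : ℤ) : expPiI ((n + 2 * k : ℤ) : ℂ) = expPiI n := by
  push_cast
  rw [expPiI_add, expPiI_two_mul_int, mul_one]

theorem expPiI_int_congr {n k : ℤ} (h : (n : ZMod 2) = k) : expPiI (n : ℂ) = expPiI k := by
  have h2 : ((n - k : ℤ) : ZMod 2) = 0 := by push_cast; rw [h, sub_self]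
  obtain ⟨l, hl⟩ := (ZMod.intCast_zmod_eq_zero_iff_dvd _ 2).1 h2
  have : n = k + 2 * l := by push_cast at hl; linarith
  rw [this, expPiI_int_add_two_mul]

theorem expPiI_one : expPiI 1 = -1 := by
  simp [expPiI]

theorem expPiI_int_of_zero {n : ℤ} (h : (n : ZMod 2) = 0) : expPiI (n : ℂ) = 1 := by
  rw [expPiI_int_congr (k := 0) (by simpa using h)]
  simp [expPiI_zero]

theorem expPiI_int_of_one {n : ℤ} (h : (n : ZMod 2) = 1) : expPiI (n : ℂ) = -1 := by
  rw [expPiI_int_congr (k := 1) (by simpa using h)]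
  simp [expPiI_one]

theorem norm_expPiI (x : ℂ) : ‖expPiI x‖ = Real.exp (-Real.pi * x.im) := by
  simp [expPiI, Complex.norm_exp]

theorem Matrix.PosDef.exists_mul_sum_sq_le {g : ℕ} {Y : Matrix (Fin g) (Fin g) ℝ}
    (hY : Y.PosDef) : ∃ c > 0, ∀ x : Fin g → ℝ, c * ∑ i, x i ^ 2 ≤ x ⬝ᵥ Y.mulVec x := by
  rcases (Metric.sphere (0 : Fin g → ℝ) 1).eq_empty_or_nonempty with he | hne
  · refine ⟨1, one_pos, fun x => ?_⟩
    have hx : x = 0 := by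
      by_contra hx
      have : ‖x‖⁻¹ • x ∈ Metric.sphere (0 : Fin g → ℝ) 1 := by
        simp [norm_smul, norm_ne_zero_iff.2 hx]
      rw [he] at this
      exact this
    simp [hx]
  · have hcont : Continuous fun x : Fin g → ℝ => x ⬝ᵥ Y.mulVec x := by
      simp only [dotProduct, mulVec]
      fun_prop
    obtain ⟨x₀, hx₀, hmin⟩ := (isCompact_sphere (0 : Fin g → ℝ) 1).exists_isMinOn hne
      hcont.continuousOn
    have hx₀' : x₀ ≠ 0 := by
      rintro rfl
      simp at hx₀
    have hpos : 0 < x₀ ⬝ᵥ Y.mulVec x₀ := by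
      simpa using hY.dotProduct_mulVec_pos hx₀'
    refine ⟨(x₀ ⬝ᵥ Y.mulVec x₀) / (g + 1), by positivity, fun x => ?_⟩
    by_cases hx : x = 0
    · simp [hx]
    have hn : 0 < ‖x‖ := norm_pos_iff.2 hx
    have hmem : ‖x‖⁻¹ • x ∈ Metric.sphere (0 : Fin g → ℝ) 1 := by
      simp [norm_smul, hn.ne']
    have h1 := hmin hmem
    simp only [Set.mem_ofPred_eq, mulVec_smul, dotProduct_smul, smul_dotProduct, smul_eq_mul] at h1
    have h2 : (x₀ ⬝ᵥ Y.mulVec x₀) * ‖x‖ ^ 2 ≤ x ⬝ᵥ Y.mulVec x := by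
      have := mul_le_mul_of_nonneg_right h1 (sq_nonneg ‖x‖)
      refine this.trans_eq ?_
      field_simp
    have h3 : ∑ i, x i ^ 2 ≤ (g + 1) * ‖x‖ ^ 2 := by
      calc ∑ i, x i ^ 2 ≤ ∑ _i : Fin g, ‖x‖ ^ 2 := by
            refine Finset.sum_le_sum fun i _ => ?_
            rw [← sq_abs]
            exact pow_le_pow_left₀ (abs_nonneg _) (norm_le_pi_norm x i) 2
        _ = g * ‖x‖ ^ 2 := by simp
        _ ≤ (g + 1) * ‖x‖ ^ 2 := by nlinarith [sq_nonneg ‖x‖]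
    calc (x₀ ⬝ᵥ Y.mulVec x₀) / (g + 1) * ∑ i, x i ^ 2
        ≤ (x₀ ⬝ᵥ Y.mulVec x₀) / (g + 1) * ((g + 1) * ‖x‖ ^ 2) := by gcongr
      _ = (x₀ ⬝ᵥ Y.mulVec x₀) * ‖x‖ ^ 2 := by field_simp
      _ ≤ _ := h2

theorem summable_pi_prod {g : ℕ} {α : Type*} {f : Fin g → α → ℝ} (h0 : ∀ i n, 0 ≤ f i n)
    (hf : ∀ i, Summable (f i)) : Summable fun n : Fin g → α => ∏ i, f i (n i) := by
  induction g with
  | zero => exact (hasSum_fintype _).summable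
  | succ k ih =>
    rw [← (Fin.consEquiv fun _ => α).summable_iff]
    have := (hf 0).mul_of_nonneg (ih (fun i => h0 i.succ) fun i => hf i.succ) (h0 0)
      fun n => Finset.prod_nonneg fun i _ => h0 _ _
    refine this.congr fun p => ?_
    simp [Fin.consEquiv, Fin.prod_univ_succ]

theorem thetaExponent_im {g : ℕ} (τ : Matrix (Fin g) (Fin g) ℂ) (x : Fin g → ℝ) (y : Fin g → ℂ) :
    (thetaExponent τ (fun i => (x i : ℂ)) y).im =
      x ⬝ᵥ (τ.map Complex.im).mulVec x + 2 * ∑ i, x i * (y i).im := by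
  simp [thetaExponent, dotProduct, mulVec, Complex.add_im, Complex.mul_im, Finset.mul_sum]

/-- A summable bound for the terms of the theta series, uniform for bounded arguments. -/
theorem exists_summable_bound_thetaTerm {g : ℕ} (m : ThetaChar g) {τ : Matrix (Fin g) (Fin g) ℂ}
    (hτ : τ ∈ siegelUpperHalfSpace g) (R : ℝ) :
    ∃ u : (Fin g → ℤ) → ℝ, Summable u ∧
      ∀ z : Fin g → ℂ, (∀ i, ‖z i‖ ≤ R) → ∀ n, ‖thetaTerm m τ z n‖ ≤ u n := by
  obtain ⟨c, hc, hY⟩ := hτ.2.exists_mul_sum_sq_le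
  let h : Fin g → ℝ := fun i => (m.1 i : ℝ) / 2
  -- The inequality `(n + h)² ≥ n²/2 - h²`, equivalent to `(n + 2h)² ≥ 0`, removes the shift by
  -- `m'/2`. What remains is a product over the coordinates of one-variable Gaussian bounds.
  let f : Fin g → ℤ → ℝ := fun i n =>
    Real.exp (Real.pi * (c * h i ^ 2 + 2 * |R| * |h i|)) *
      Real.exp (-Real.pi * (c / 2 * (n : ℝ) ^ 2 - 2 * |R| * |(n : ℝ)|))
  have hf : ∀ i, Summable (f i) := fun i => by
    have := summable_pow_mul_jacobiTheta₂_term_bound |R| (half_pos hc) 0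
    simp only [pow_zero, one_mul, Int.cast_abs] at this
    exact this.mul_left _
  refine ⟨fun n => ∏ i, f i (n i), summable_pi_prod (fun i n => by positivity) hf, ?_⟩
  intro z hz n
  have hx : charPoint m n = fun i => (((n i : ℝ) + h i : ℝ) : ℂ) := by
    funext i
    simp [charPoint, h]
  rw [thetaTerm, norm_expPiI, hx, thetaExponent_im]
  simp only [f, ← Real.exp_add]
  rw [← Real.exp_sum, Real.exp_le_exp]
  have hpi := Real.pi_pos
  have hq := hY fun i => (n i : ℝ) + h i
  have key : ∀ i, -(c * ((n i : ℝ) + h i) ^ 2 + 2 * (((n i : ℝ) + h i) * (charArg m z i).im)) ≤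
      (c * h i ^ 2 + 2 * |R| * |h i|) - (c / 2 * (n i : ℝ) ^ 2 - 2 * |R| * |(n i : ℝ)|) := by
    intro i
    have him : (charArg m z i).im = (z i).im := by
      simp [charArg]
    rw [him]
    have hzi : |(z i).im| ≤ |R| := (Complex.abs_im_le_norm _).trans ((hz i).trans (le_abs_self R))
    have hb : |((n i : ℝ) + h i) * (z i).im| ≤ (|(n i : ℝ)| + |h i|) * |R| := by
      rw [abs_mul]
      exact mul_le_mul (abs_add_le _ _) hzi (abs_nonneg _) (by positivity)
    have hb' := (abs_le.1 hb).1
    nlinarith [mul_nonneg hc.le (sq_nonneg ((n i : ℝ) + 2 * h i))]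
  have hsum := Finset.sum_le_sum fun i (_ : i ∈ Finset.univ) => key i
  rw [Finset.sum_neg_distrib, Finset.sum_add_distrib, ← Finset.mul_sum, ← Finset.mul_sum] at hsum
  have h1 := mul_le_mul_of_nonneg_left hsum hpi.le
  refine le_trans ?_ (h1.trans_eq ((Finset.mul_sum _ _ _).trans
    (Finset.sum_congr rfl fun i _ => by ring)))
  have h2 := mul_le_mul_of_nonneg_left hq hpi.le
  nlinarith

theorem summable_norm_thetaTerm {g : ℕ} (m : ThetaChar g) {τ : Matrix (Fin g) (Fin g) ℂ}
    (hτ : τ ∈ siegelUpperHalfSpace g) (z : Fin g → ℂ) :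
    Summable fun n => ‖thetaTerm m τ z n‖ := by
  obtain ⟨u, hu, hb⟩ := exists_summable_bound_thetaTerm m hτ ‖z‖
  exact hu.of_nonneg_of_le (fun _ => norm_nonneg _) (hb z (norm_le_pi_norm z))

theorem differentiableAt_riemannTheta_single {g : ℕ} (m : ThetaChar g)
    {τ : Matrix (Fin g) (Fin g) ℂ} (hτ : τ ∈ siegelUpperHalfSpace g) (j : Fin g) :
    DifferentiableAt ℂ (fun t : ℂ => riemannTheta m τ (Pi.single j t)) 0 := by
  obtain ⟨u, hu, hb⟩ := exists_summable_bound_thetaTerm m hτ 1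
  have hd : DifferentiableOn ℂ (fun t : ℂ => ∑' n, thetaTerm m τ (Pi.single j t) n)
      (Metric.ball 0 1) := by
    refine Complex.differentiableOn_tsum_of_summable_norm hu (fun n => ?_) Metric.isOpen_ball
      fun n t ht => hb _ (fun i => ?_) n
    · have hs : ∀ i, Differentiable ℂ fun t : ℂ => (Pi.single j t : Fin g → ℂ) i := fun i => by
        by_cases hij : i = j
        · subst hij; simp
        · simp [hij]
      simp only [thetaTerm, thetaExponent, charArg, expPiI, dotProduct]
      apply Differentiable.differentiableOn
      fun_prop
    · rw [mem_ball_zero_iff] at ht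
      by_cases hij : i = j
      · subst hij; simpa using ht.le
      · simp [hij]
  exact hd.differentiableAt (Metric.isOpen_ball.mem_nhds (by simp))

/-! ### Change of characteristic and parity. -/

/-- Adding `2b'` to `m'` only reindexes the lattice, while adding `2b''` to `m''` shifts `z` by an
integral vector and produces the sign. This sign is why sums of characteristics must not be reduced
modulo `2`. -/
theorem riemannTheta_add_two_mul {g : ℕ} (m : ThetaChar g) (b : ThetaChar g)
    (τ : Matrix (Fin g) (Fin g) ℂ) (z : Fin g → ℂ) :
    riemannTheta (m + 2 • b) τ z = expPiI ((m.1 ⬝ᵥ b.2 : ℤ) : ℂ) * riemannTheta m τ z := by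
  rw [riemannTheta_eq_tsum, riemannTheta_eq_tsum, 
    ← (Equiv.addRight b.1).tsum_eq (thetaTerm m τ z), ← tsum_mul_left]
  refine tsum_congr fun n => ?_
  have h1 : charPoint (m + 2 • b) n = charPoint m (Equiv.addRight b.1 n) := by
    funext i
    simp [charPoint]
    ring
  have h2 : charArg (m + 2 • b) z = charArg m z + fun i => (b.2 i : ℂ) := by
    funext i
    simp [charArg]
    ring
  have h3 : 2 * (charPoint m (Equiv.addRight b.1 n) ⬝ᵥ fun i => (b.2 i : ℂ)) =
      ((m.1 ⬝ᵥ b.2 + 2 * ((Equiv.addRight b.1 n) ⬝ᵥ b.2) : ℤ) : ℂ) := by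
    simp only [charPoint, dotProduct, Int.cast_add, Int.cast_mul, Int.cast_sum, Int.cast_ofNat,
      Finset.mul_sum, ← Finset.sum_add_distrib]
    exact Finset.sum_congr rfl fun i _ => by ring
  rw [thetaTerm, thetaTerm, ← expPiI_int_add_two_mul _ ((Equiv.addRight b.1 n) ⬝ᵥ b.2), ← h3,
    ← expPiI_add, h1, h2]
  congr 1
  simp only [thetaExponent, dotProduct_add]
  ring

/-- The substitution `n ↦ -m' - n` negates the lattice point `n + m'/2`. -/
theorem riemannTheta_neg {g : ℕ} (m : ThetaChar g) (τ : Matrix (Fin g) (Fin g) ℂ)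
    (z : Fin g → ℂ) :
    riemannTheta m τ (-z) = expPiI ((m.1 ⬝ᵥ m.2 : ℤ) : ℂ) * riemannTheta m τ z := by
  rw [riemannTheta_eq_tsum, riemannTheta_eq_tsum, ← (Equiv.subLeft (-m.1)).tsum_eq,
    ← tsum_mul_left]
  refine tsum_congr fun n => ?_
  have h1 : charPoint m (Equiv.subLeft (-m.1) n) = -charPoint m n := by
    funext i
    simp [charPoint]
    ring
  have h2 : charArg m (-z) = -charArg m z + fun i => (m.2 i : ℂ) := by
    funext i
    simp [charArg]
    ring
  have h3 : -(2 * (charPoint m n ⬝ᵥ fun i => (m.2 i : ℂ))) =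
      ((m.1 ⬝ᵥ m.2 + 2 * (-(n ⬝ᵥ m.2) - m.1 ⬝ᵥ m.2) : ℤ) : ℂ) := by
    simp only [charPoint, dotProduct, Int.cast_add, Int.cast_sub, Int.cast_neg, Int.cast_mul,
      Int.cast_sum, Int.cast_ofNat, mul_sub, mul_neg, Finset.mul_sum, ← Finset.sum_add_distrib,
      ← Finset.sum_neg_distrib, ← Finset.sum_sub_distrib]
    exact Finset.sum_congr rfl fun i _ => by ring
  rw [thetaTerm, thetaTerm, ← expPiI_int_add_two_mul _ (-(n ⬝ᵥ m.2) - m.1 ⬝ᵥ m.2), ← h3,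
    ← expPiI_add, h1, h2]
  congr 1
  simp only [thetaExponent, dotProduct_add, mulVec_neg, neg_dotProduct, dotProduct_neg]
  ring

theorem riemannTheta_zero_of_odd {g : ℕ} (m : ThetaChar g) (τ : Matrix (Fin g) (Fin g) ℂ)
    (h : ((m.1 ⬝ᵥ m.2 : ℤ) : ZMod 2) = 1) : riemannTheta m τ 0 = 0 := by
  have := riemannTheta_neg m τ 0
  rw [neg_zero, expPiI_int_of_one h] at this
  linear_combination this / 2

theorem thetaGrad_of_even {g : ℕ} (m : ThetaChar g) (τ : Matrix (Fin g) (Fin g) ℂ)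
    (h : ((m.1 ⬝ᵥ m.2 : ℤ) : ZMod 2) = 0) (j : Fin g) : thetaGrad m τ j = 0 := by
  have h1 : ∀ t : ℂ, riemannTheta m τ (Pi.single j (-t)) = riemannTheta m τ (Pi.single j t) := by
    intro t
    have := riemannTheta_neg m τ (Pi.single j t)
    rwa [expPiI_int_of_zero h, one_mul, ← Pi.single_neg] at this
  have h2 := deriv_comp_neg (fun t : ℂ => riemannTheta m τ (Pi.single j t)) 0
  simp only [h1, neg_zero] at h2
  unfold thetaGrad
  linear_combination h2 / 2

theorem thetaGrad_add_two_mul {g : ℕ} (m : ThetaChar g) (b : ThetaChar g)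
    (τ : Matrix (Fin g) (Fin g) ℂ) (j : Fin g) :
    thetaGrad (m + 2 • b) τ j = expPiI ((m.1 ⬝ᵥ b.2 : ℤ) : ℂ) * thetaGrad m τ j := by
  simp only [thetaGrad, riemannTheta_add_two_mul]
  rw [deriv_const_mul_field]

theorem thetaConst_add_two_mul {g : ℕ} (m : ThetaChar g) (b : ThetaChar g)
    (τ : Matrix (Fin g) (Fin g) ℂ) :
    thetaConst (m + 2 • b) τ = expPiI ((m.1 ⬝ᵥ b.2 : ℤ) : ℂ) * thetaConst m τ :=
  riemannTheta_add_two_mul m b τ 0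

/-! ### Riemann's theta formula. -/

/-- The representative with entries in `{0, 1}` of a characteristic modulo `2`. -/
def liftChar {g : ℕ} (a : SympSpace g) : ThetaChar g :=
  (fun i => ((a.1 i).val : ℤ), fun i => ((a.2 i).val : ℤ))

theorem expPiI_sum {ι : Type*} (s : Finset ι) (f : ι → ℂ) :
    expPiI (∑ i ∈ s, f i) = ∏ i ∈ s, expPiI (f i) := by
  simp [expPiI, Finset.mul_sum, Complex.exp_sum]

-- Orthogonality of characters on `𝔽₂^g`, factored over the coordinates. It will detect which
-- quadruples of lattice vectors have even sum.
open Classical in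
theorem sum_expPiI_dotProduct_val {g : ℕ} (s : Fin g → ℤ) :
    ∑ b : Fin g → ZMod 2, expPiI ((s ⬝ᵥ (liftChar (0, b)).2 : ℤ) : ℂ) =
      if ∀ i, Even (s i) then 2 ^ g else 0 := by
  have h1 : ∀ b : Fin g → ZMod 2, expPiI ((s ⬝ᵥ (liftChar (0, b)).2 : ℤ) : ℂ) =
      ∏ i, expPiI ((s i * (b i).val : ℤ) : ℂ) := fun b => by
    rw [← expPiI_sum]
    simp [dotProduct, liftChar]
  have h2 : ∀ i, ∑ c : ZMod 2, expPiI ((s i * c.val : ℤ) : ℂ) = if Even (s i) then 2 else 0 := by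
    intro i
    have : ∑ c : ZMod 2, expPiI ((s i * c.val : ℤ) : ℂ) = 1 + expPiI (s i) := by
      change ∑ c : Fin 2, expPiI ((s i * (ZMod.val (n := 2) c) : ℤ) : ℂ) = _
      rw [Fin.sum_univ_two]
      have h0 : ZMod.val (n := 2) (0 : Fin 2) = 0 := rfl
      have h1 : ZMod.val (n := 2) (1 : Fin 2) = 1 := rfl
      simp [h0, h1, expPiI_zero]
    rw [this]
    split_ifs with he
    · rw [expPiI_int_of_zero ((ZMod.intCast_zmod_eq_zero_iff_dvd _ 2).2 he.two_dvd)]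
      norm_num
    · rw [expPiI_int_of_one, add_neg_cancel]
      obtain ⟨l, hl⟩ := Int.not_even_iff_odd.1 he
      rw [hl]
      push_cast
      rw [show (2 : ZMod 2) = 0 from rfl, zero_mul, zero_add]
  simp_rw [h1]
  rw [← Fintype.prod_sum fun i (c : ZMod 2) => expPiI ((s i * c.val : ℤ) : ℂ)]
  simp_rw [h2]
  split_ifs with h
  · simp [h]
  · push Not at h
    obtain ⟨i, hi⟩ := h
    exact Finset.prod_eq_zero (Finset.mem_univ i) (by rw [if_neg (by simpa using hi)])

theorem thetaTerm_add_char {g : ℕ} (m : ThetaChar g) (a b : Fin g → ℤ)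
    (τ : Matrix (Fin g) (Fin g) ℂ) (z : Fin g → ℂ) (n : Fin g → ℤ) :
    thetaTerm (m + (a, b)) τ z n =
      expPiI (charPoint (m + (a, 0)) n ⬝ᵥ fun i => (b i : ℂ)) * thetaTerm (m + (a, 0)) τ z n := by
  have h1 : charPoint (m + (a, b)) n = charPoint (m + (a, 0)) n := rfl
  have h2 : charArg (m + (a, b)) z = charArg (m + (a, 0)) z + fun i => (b i : ℂ) / 2 := by
    funext i
    simp [charArg]
    ring
  have h3 : (charPoint (m + (a, 0)) n ⬝ᵥ fun i => (b i : ℂ)) =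
      2 * (charPoint (m + (a, 0)) n ⬝ᵥ fun i => (b i : ℂ) / 2) := by
    simp only [dotProduct, Finset.mul_sum]
    exact Finset.sum_congr rfl fun i _ => by ring
  rw [thetaTerm, thetaTerm, ← expPiI_add, h1, h2, h3]
  congr 1
  simp only [thetaExponent, dotProduct_add]
  ring

/-- The relations `k = T h` with `T` the symmetric orthogonal `4 × 4` matrix with entries `± 1/2`
of Riemann's theta formula. -/
structure RiemannRelated {M : Type*} [AddCommGroup M] (h₁ h₂ h₃ h₄ k₁ k₂ k₃ k₄ : M) : Prop where
  one : 2 • k₁ = h₁ + h₂ + h₃ + h₄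
  two : 2 • k₂ = h₁ + h₂ - h₃ - h₄
  three : 2 • k₃ = h₁ - h₂ + h₃ - h₄
  four : 2 • k₄ = h₁ - h₂ - h₃ + h₄

/-- The matrix `T` is orthogonal, so applying it to both arguments preserves the sum over the four
indices of any bilinear expression. -/
theorem thetaExponent_riemannRelated {g : ℕ} (τ : Matrix (Fin g) (Fin g) ℂ)
    {p₁ p₂ p₃ p₄ n₁ n₂ n₃ n₄ y₁ y₂ y₃ y₄ x₁ x₂ x₃ x₄ : Fin g → ℂ}
    (hn : RiemannRelated p₁ p₂ p₃ p₄ n₁ n₂ n₃ n₄) (hx : RiemannRelated y₁ y₂ y₃ y₄ x₁ x₂ x₃ x₄) :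
    thetaExponent τ n₁ x₁ + thetaExponent τ n₂ x₂ + thetaExponent τ n₃ x₃ + thetaExponent τ n₄ x₄ =
    thetaExponent τ p₁ y₁ + thetaExponent τ p₂ y₂ + thetaExponent τ p₃ y₃ +
      thetaExponent τ p₄ y₄ := by
  have half : ∀ {a b : Fin g → ℂ}, 2 • a = b → a = (1 / 2 : ℂ) • b := by
    rintro a _ rfl
    funext i
    simp
  rw [half hn.one, half hn.two, half hn.three, half hn.four, half hx.one, half hx.two,
    half hx.three, half hx.four]
  simp only [thetaExponent, mulVec_smul, mulVec_add, mulVec_sub, dotProduct_smul, smul_dotProduct,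
    dotProduct_add, dotProduct_sub, add_dotProduct, sub_dotProduct, smul_eq_mul]
  ring

/-- All dependence on `b` is collected in one sign: since `k₁ + k₂ + k₃ + k₄ = 2h₁`, the
half-integral parts of the four lattice points add up to an integral vector, which the prefactor
cancels modulo `2`. -/
theorem sum_expPiI_mul_thetaTerm {g : ℕ} (τ : Matrix (Fin g) (Fin g) ℂ)
    {h₁ h₂ h₃ h₄ k₁ k₂ k₃ k₄ : ThetaChar g} (hk : RiemannRelated h₁ h₂ h₃ h₄ k₁ k₂ k₃ k₄)
    (x₁ x₂ x₃ x₄ : Fin g → ℂ) (a b n₁ n₂ n₃ n₄ : Fin g → ℤ) :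
    expPiI ((h₁.1 ⬝ᵥ b : ℤ) : ℂ) * (thetaTerm (k₁ + (a, b)) τ x₁ n₁ *
      thetaTerm (k₂ + (a, b)) τ x₂ n₂ * (thetaTerm (k₃ + (a, b)) τ x₃ n₃ *
      thetaTerm (k₄ + (a, b)) τ x₄ n₄)) =
    expPiI (((n₁ + n₂ + n₃ + n₄) ⬝ᵥ b : ℤ) : ℂ) * (thetaTerm (k₁ + (a, 0)) τ x₁ n₁ *
      thetaTerm (k₂ + (a, 0)) τ x₂ n₂ * (thetaTerm (k₃ + (a, 0)) τ x₃ n₃ *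
      thetaTerm (k₄ + (a, 0)) τ x₄ n₄)) := by
  rw [thetaTerm_add_char k₁, thetaTerm_add_char k₂, thetaTerm_add_char k₃, thetaTerm_add_char k₄]
  have key : ((h₁.1 ⬝ᵥ b : ℤ) : ℂ) + (charPoint (k₁ + (a, 0)) n₁ ⬝ᵥ fun i => (b i : ℂ)) +
      (charPoint (k₂ + (a, 0)) n₂ ⬝ᵥ fun i => (b i : ℂ)) +
      (charPoint (k₃ + (a, 0)) n₃ ⬝ᵥ fun i => (b i : ℂ)) +
      (charPoint (k₄ + (a, 0)) n₄ ⬝ᵥ fun i => (b i : ℂ)) =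
      (((n₁ + n₂ + n₃ + n₄) ⬝ᵥ b + 2 * ((h₁.1 + a) ⬝ᵥ b) : ℤ) : ℂ) := by
    simp only [charPoint, dotProduct, Int.cast_add, Int.cast_mul, Int.cast_sum, Int.cast_ofNat,
      Finset.mul_sum, ← Finset.sum_add_distrib]
    refine Finset.sum_congr rfl fun i _ => ?_
    have e1 := congrFun (congrArg Prod.fst hk.one) i
    have e2 := congrFun (congrArg Prod.fst hk.two) i
    have e3 := congrFun (congrArg Prod.fst hk.three) i
    have e4 := congrFun (congrArg Prod.fst hk.four) i
    simp only [two_nsmul, Prod.fst_add, Prod.fst_sub, Pi.add_apply, Pi.sub_apply] at e1 e2 e3 e4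
    have e5 : k₁.1 i + k₂.1 i + k₃.1 i + k₄.1 i = 2 * h₁.1 i := by
      linarith
    have e6 : (k₁.1 i : ℂ) + k₂.1 i + k₃.1 i + k₄.1 i = 2 * h₁.1 i := by exact_mod_cast e5
    simp only [Prod.fst_add, Pi.add_apply, Int.cast_add]
    linear_combination (b i : ℂ) / 2 * e6
  rw [← expPiI_int_add_two_mul ((n₁ + n₂ + n₃ + n₄) ⬝ᵥ b) ((h₁.1 + a) ⬝ᵥ b), ← key]
  simp only [expPiI_add]
  ring

/-- The four integral vectors `⌊T p⌋`, together with the common parity of `2 T p`. -/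
def riemannIndex {g : ℕ} (p : ((Fin g → ℤ) × (Fin g → ℤ)) × ((Fin g → ℤ) × (Fin g → ℤ))) :
    (Fin g → ZMod 2) × (((Fin g → ℤ) × (Fin g → ℤ)) × ((Fin g → ℤ) × (Fin g → ℤ))) :=
  (fun i => ((p.1.1 i + p.1.2 i + p.2.1 i + p.2.2 i : ℤ) : ZMod 2),
    ((fun i => (p.1.1 i + p.1.2 i + p.2.1 i + p.2.2 i) / 2,
      fun i => (p.1.1 i + p.1.2 i - p.2.1 i - p.2.2 i) / 2),
     (fun i => (p.1.1 i - p.1.2 i + p.2.1 i - p.2.2 i) / 2,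
      fun i => (p.1.1 i - p.1.2 i - p.2.1 i + p.2.2 i) / 2)))

theorem riemannIndex_fst_val {g : ℕ}
    (p : ((Fin g → ℤ) × (Fin g → ℤ)) × ((Fin g → ℤ) × (Fin g → ℤ))) (i : Fin g) :
    (((riemannIndex p).1 i).val : ℤ) = (p.1.1 i + p.1.2 i + p.2.1 i + p.2.2 i) % 2 := by
  rw [riemannIndex, ZMod.val_intCast]
  rfl

theorem riemannIndex_injective {g : ℕ} : Function.Injective (riemannIndex (g := g)) := by
  intro p q h
  have h0 : ∀ i, (p.1.1 i + p.1.2 i + p.2.1 i + p.2.2 i) % 2 =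
      (q.1.1 i + q.1.2 i + q.2.1 i + q.2.2 i) % 2 := fun i => by
    rw [← riemannIndex_fst_val, ← riemannIndex_fst_val, h]
  have h1 : ∀ i, _ := fun i => congrFun (congrArg (fun r => r.2.1.1) h) i
  have h2 : ∀ i, _ := fun i => congrFun (congrArg (fun r => r.2.1.2) h) i
  have h3 : ∀ i, _ := fun i => congrFun (congrArg (fun r => r.2.2.1) h) i
  have h4 : ∀ i, _ := fun i => congrFun (congrArg (fun r => r.2.2.2) h) i
  simp only [riemannIndex] at h1 h2 h3 h4
  refine Prod.ext (Prod.ext ?_ ?_) (Prod.ext ?_ ?_) <;> funext i <;>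
    have := h0 i <;> have := h1 i <;> have := h2 i <;> have := h3 i <;> have := h4 i <;> omega

theorem mem_range_riemannIndex {g : ℕ} (a : Fin g → ZMod 2) (n₁ n₂ n₃ n₄ : Fin g → ℤ)
    (h : ∀ i, Even ((n₁ + n₂ + n₃ + n₄) i)) :
    (a, ((n₁, n₂), (n₃, n₄))) ∈ Set.range (riemannIndex (g := g)) := by
  have hv : ∀ i, (0 : ℤ) ≤ (a i).val ∧ ((a i).val : ℤ) < 2 := fun i =>
    ⟨by positivity, by exact_mod_cast (a i).val_lt⟩
  -- The preimage is `T` applied to `n + (a, a, a, a)/2`. As `T(1,1,1,1) = (2,0,0,0)`, the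
  -- contribution of `a` enters the first vector alone.
  refine ⟨((fun i => (n₁ i + n₂ i + n₃ i + n₄ i) / 2 + (a i).val,
    fun i => (n₁ i + n₂ i - n₃ i - n₄ i) / 2), (fun i => (n₁ i - n₂ i + n₃ i - n₄ i) / 2,
    fun i => (n₁ i - n₂ i - n₃ i + n₄ i) / 2)), ?_⟩
  refine Prod.ext ?_ (Prod.ext (Prod.ext ?_ ?_) (Prod.ext ?_ ?_)) <;> funext i <;>
    obtain ⟨l, hl⟩ := h i <;> have := hv i <;> simp only [Pi.add_apply] at hl
  · apply ZMod.val_injective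
    zify
    rw [riemannIndex_fst_val]
    dsimp only
    omega
  all_goals
    simp only [riemannIndex]
    omega

/-- With `a` the parity part of the index and `nᵢ` its floors, the lattice points `nᵢ + (kᵢ + a)/2`
are the image under `T` of the points `pᵢ + hᵢ/2`, so the orthogonality of `T` applies. -/
theorem thetaTerm_riemannIndex {g : ℕ} (τ : Matrix (Fin g) (Fin g) ℂ)
    {h₁ h₂ h₃ h₄ k₁ k₂ k₃ k₄ : ThetaChar g} (hk : RiemannRelated h₁ h₂ h₃ h₄ k₁ k₂ k₃ k₄)
    {y₁ y₂ y₃ y₄ x₁ x₂ x₃ x₄ : Fin g → ℂ} (hx : RiemannRelated y₁ y₂ y₃ y₄ x₁ x₂ x₃ x₄)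
    (p : ((Fin g → ℤ) × (Fin g → ℤ)) × ((Fin g → ℤ) × (Fin g → ℤ))) :
    thetaTerm (k₁ + ((liftChar ((riemannIndex p).1, 0)).1, 0)) τ x₁ (riemannIndex p).2.1.1 *
      thetaTerm (k₂ + ((liftChar ((riemannIndex p).1, 0)).1, 0)) τ x₂ (riemannIndex p).2.1.2 *
      (thetaTerm (k₃ + ((liftChar ((riemannIndex p).1, 0)).1, 0)) τ x₃ (riemannIndex p).2.2.1 *
      thetaTerm (k₄ + ((liftChar ((riemannIndex p).1, 0)).1, 0)) τ x₄ (riemannIndex p).2.2.2) =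
    thetaTerm h₁ τ y₁ p.1.1 * thetaTerm h₂ τ y₂ p.1.2 *
      (thetaTerm h₃ τ y₃ p.2.1 * thetaTerm h₄ τ y₄ p.2.2) := by
  simp only [thetaTerm, ← expPiI_add, ← add_assoc]
  congr 1
  apply thetaExponent_riemannRelated
  · have cast : ∀ {a b c d e : ℤ}, 2 * a = b + c + d + e →
        (2 * a : ℂ) = b + c + d + e := fun h => by exact_mod_cast h
    constructor <;> funext i <;> have hv := riemannIndex_fst_val p i
    · have e := congrFun (congrArg Prod.fst hk.one) i
      have e' : 2 * (2 * (riemannIndex p).2.1.1 i + ((riemannIndex p).1 i).val + k₁.1 i) =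
        (2 * p.1.1 i + h₁.1 i) + (2 * p.1.2 i + h₂.1 i) + (2 * p.2.1 i + h₃.1 i) +
          (2 * p.2.2 i + h₄.1 i) := by
        rw [hv]
        simp [riemannIndex] at e ⊢
        omega
      have e2 := cast e'
      simp [charPoint, liftChar] at e2 ⊢
      linear_combination e2 / 2
    · have e := congrFun (congrArg Prod.fst hk.two) i
      have e' : 2 * (2 * (riemannIndex p).2.1.2 i + ((riemannIndex p).1 i).val + k₂.1 i) =
        (2 * p.1.1 i + h₁.1 i) + (2 * p.1.2 i + h₂.1 i) + -(2 * p.2.1 i + h₃.1 i) +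
          -(2 * p.2.2 i + h₄.1 i) := by
        rw [hv]
        simp [riemannIndex] at e ⊢
        omega
      have e2 := cast e'
      simp [charPoint, liftChar] at e2 ⊢
      linear_combination e2 / 2
    · have e := congrFun (congrArg Prod.fst hk.three) i
      have e' : 2 * (2 * (riemannIndex p).2.2.1 i + ((riemannIndex p).1 i).val + k₃.1 i) =
        (2 * p.1.1 i + h₁.1 i) + -(2 * p.1.2 i + h₂.1 i) + (2 * p.2.1 i + h₃.1 i) +
          -(2 * p.2.2 i + h₄.1 i) := by
        rw [hv]
        simp [riemannIndex] at e ⊢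
        omega
      have e2 := cast e'
      simp [charPoint, liftChar] at e2 ⊢
      linear_combination e2 / 2
    · have e := congrFun (congrArg Prod.fst hk.four) i
      have e' : 2 * (2 * (riemannIndex p).2.2.2 i + ((riemannIndex p).1 i).val + k₄.1 i) =
        (2 * p.1.1 i + h₁.1 i) + -(2 * p.1.2 i + h₂.1 i) + -(2 * p.2.1 i + h₃.1 i) +
          (2 * p.2.2 i + h₄.1 i) := by
        rw [hv]
        simp [riemannIndex] at e ⊢
        omega
      have e2 := cast e'
      simp [charPoint, liftChar] at e2 ⊢
      linear_combination e2 / 2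
  · have hz : ∀ (k : ThetaChar g) (a : Fin g → ℤ) (x : Fin g → ℂ),
        charArg (k + (a, 0)) x = charArg k x := fun k a x => by
      funext i
      simp [charArg]
    simp only [hz]
    constructor <;> funext i
    · have e := congrFun (congrArg Prod.snd hk.one) i
      have f := congrFun hx.one i
      have e2 := congrArg (Int.cast : ℤ → ℂ) e
      simp [charArg] at e2 f ⊢
      linear_combination e2 / 2 + f
    · have e := congrFun (congrArg Prod.snd hk.two) i
      have f := congrFun hx.two i
      have e2 := congrArg (Int.cast : ℤ → ℂ) e
      simp [charArg] at e2 f ⊢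
      linear_combination e2 / 2 + f
    · have e := congrFun (congrArg Prod.snd hk.three) i
      have f := congrFun hx.three i
      have e2 := congrArg (Int.cast : ℤ → ℂ) e
      simp [charArg] at e2 f ⊢
      linear_combination e2 / 2 + f
    · have e := congrFun (congrArg Prod.snd hk.four) i
      have f := congrFun hx.four i
      have e2 := congrArg (Int.cast : ℤ → ℂ) e
      simp [charArg] at e2 f ⊢
      linear_combination e2 / 2 + f

theorem riemannTheta_mul_four {g : ℕ} {τ : Matrix (Fin g) (Fin g) ℂ}
    (hτ : τ ∈ siegelUpperHalfSpace g) (m₁ m₂ m₃ m₄ : ThetaChar g) (x₁ x₂ x₃ x₄ : Fin g → ℂ) :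
    HasSum (fun p : ((Fin g → ℤ) × (Fin g → ℤ)) × ((Fin g → ℤ) × (Fin g → ℤ)) =>
      thetaTerm m₁ τ x₁ p.1.1 * thetaTerm m₂ τ x₂ p.1.2 *
        (thetaTerm m₃ τ x₃ p.2.1 * thetaTerm m₄ τ x₄ p.2.2))
      (riemannTheta m₁ τ x₁ * riemannTheta m₂ τ x₂ *
        (riemannTheta m₃ τ x₃ * riemannTheta m₄ τ x₄)) := by
  have s := fun m x => summable_norm_thetaTerm (g := g) m hτ x
  have s12 := (s m₁ x₁).mul_norm (s m₂ x₂)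
  have s34 := (s m₃ x₃).mul_norm (s m₄ x₄)
  simp only [riemannTheta_eq_tsum]
  rw [tsum_mul_tsum_of_summable_norm (s m₁ x₁) (s m₂ x₂),
    tsum_mul_tsum_of_summable_norm (s m₃ x₃) (s m₄ x₄),
    tsum_mul_tsum_of_summable_norm s12 s34]
  exact (summable_mul_of_summable_norm s12 s34).hasSum

/-- **Riemann's theta formula**. -/
theorem riemann_theta_formula {g : ℕ} {τ : Matrix (Fin g) (Fin g) ℂ}
    (hτ : τ ∈ siegelUpperHalfSpace g)
    {h₁ h₂ h₃ h₄ k₁ k₂ k₃ k₄ : ThetaChar g} (hk : RiemannRelated h₁ h₂ h₃ h₄ k₁ k₂ k₃ k₄)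
    {y₁ y₂ y₃ y₄ x₁ x₂ x₃ x₄ : Fin g → ℂ} (hx : RiemannRelated y₁ y₂ y₃ y₄ x₁ x₂ x₃ x₄) :
    ∑ a : SympSpace g, expPiI ((h₁.1 ⬝ᵥ (liftChar a).2 : ℤ) : ℂ) *
      (riemannTheta (k₁ + liftChar a) τ x₁ * riemannTheta (k₂ + liftChar a) τ x₂ *
        (riemannTheta (k₃ + liftChar a) τ x₃ * riemannTheta (k₄ + liftChar a) τ x₄)) =
    2 ^ g * (riemannTheta h₁ τ y₁ * riemannTheta h₂ τ y₂ *
      (riemannTheta h₃ τ y₃ * riemannTheta h₄ τ y₄)) := by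
  classical
  -- `F` is summed in two ways. Over the fibres of `a`, its parity factor unfolds into the sum over
  -- `b` and gives the left side. Pulled back along the injection `riemannIndex`, whose range
  -- contains its support, it gives the right side.
  let F : (Fin g → ZMod 2) × (((Fin g → ℤ) × (Fin g → ℤ)) × ((Fin g → ℤ) × (Fin g → ℤ))) → ℂ :=
    fun q => (if ∀ i, Even ((q.2.1.1 + q.2.1.2 + q.2.2.1 + q.2.2.2) i) then 2 ^ g else 0) *
      (thetaTerm (k₁ + ((liftChar (q.1, 0)).1, 0)) τ x₁ q.2.1.1 *
        thetaTerm (k₂ + ((liftChar (q.1, 0)).1, 0)) τ x₂ q.2.1.2 *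
        (thetaTerm (k₃ + ((liftChar (q.1, 0)).1, 0)) τ x₃ q.2.2.1 *
        thetaTerm (k₄ + ((liftChar (q.1, 0)).1, 0)) τ x₄ q.2.2.2))
  have hfib : ∀ a : Fin g → ZMod 2, HasSum (fun p => F (a, p))
      (∑ b : Fin g → ZMod 2, expPiI ((h₁.1 ⬝ᵥ (liftChar (a, b)).2 : ℤ) : ℂ) *
      (riemannTheta (k₁ + liftChar (a, b)) τ x₁ * riemannTheta (k₂ + liftChar (a, b)) τ x₂ *
        (riemannTheta (k₃ + liftChar (a, b)) τ x₃ *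
          riemannTheta (k₄ + liftChar (a, b)) τ x₄))) := by
    intro a
    have := hasSum_sum fun (b : Fin g → ZMod 2) (_ : b ∈ Finset.univ) =>
      (riemannTheta_mul_four hτ (k₁ + liftChar (a, b)) (k₂ + liftChar (a, b))
        (k₃ + liftChar (a, b)) (k₄ + liftChar (a, b)) x₁ x₂ x₃ x₄).mul_left
        (expPiI ((h₁.1 ⬝ᵥ (liftChar (a, b)).2 : ℤ) : ℂ))
    refine this.congr_fun fun p => ?_
    simp only [F]
    rw [← sum_expPiI_dotProduct_val, Finset.sum_mul]
    exact Finset.sum_congr rfl fun b _ => (sum_expPiI_mul_thetaTerm τ hk x₁ x₂ x₃ x₄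
      (liftChar (a, 0)).1 (liftChar (0, b)).2 _ _ _ _).symm
  have hsupp : Function.support F ⊆ Set.range (riemannIndex (g := g)) := by
    rintro ⟨a, ⟨n₁, n₂⟩, n₃, n₄⟩ hq
    refine mem_range_riemannIndex a n₁ n₂ n₃ n₄ ?_
    by_contra hne
    exact hq (by simp only [F]; rw [if_neg hne, zero_mul])
  have hF : ∀ p, F (riemannIndex p) = 2 ^ g * (thetaTerm h₁ τ y₁ p.1.1 *
      thetaTerm h₂ τ y₂ p.1.2 * (thetaTerm h₃ τ y₃ p.2.1 * thetaTerm h₄ τ y₄ p.2.2)) := by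
    intro p
    simp only [F]
    rw [thetaTerm_riemannIndex τ hk hx, if_pos]
    intro i
    refine ⟨p.1.1 i - ((p.1.1 i + p.1.2 i + p.2.1 i + p.2.2 i) % 2), ?_⟩
    simp only [riemannIndex, Pi.add_apply]
    omega
  have hR := (riemannTheta_mul_four hτ h₁ h₂ h₃ h₄ y₁ y₂ y₃ y₄).mul_left ((2 : ℂ) ^ g)
  have hR' : HasSum F (2 ^ g * (riemannTheta h₁ τ y₁ * riemannTheta h₂ τ y₂ *
      (riemannTheta h₃ τ y₃ * riemannTheta h₄ τ y₄))) := by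
    rw [← riemannIndex_injective.hasSum_iff fun q hq => Function.notMem_support.1 fun h =>
      hq (hsupp h)]
    exact hR.congr_fun hF
  have := hR'.prod_fiberwise hfib
  rw [Fintype.sum_prod_type]
  exact (hasSum_fintype _).unique this

/-! ### Symplectic and quadratic algebra over `𝔽₂`. -/

/-- The Arf invariant of the form with coordinates `m`. -/
def arfVec {g : ℕ} (m : SympSpace g) : ZMod 2 := m.1 ⬝ᵥ m.2

/-- The value at `a` of the quadratic form with coordinates `m`, up to exchanging the two halves of
`a`: the change of the Arf invariant from `m` to `m + a`. -/
def arfDiff {g : ℕ} (m a : SympSpace g) : ZMod 2 := arfVec (m + a) + arfVec m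

section sympForm

variable {g : ℕ} (a b c : SympSpace g)

@[simp] theorem sympForm_add_left : sympForm (a + b) c = sympForm a c + sympForm b c := by
  simp only [sympForm, Prod.fst_add, Prod.snd_add, add_dotProduct, dotProduct_add]
  ring

theorem sympForm_comm : sympForm a b = sympForm b a := by
  simp only [sympForm]
  ring

@[simp] theorem sympForm_add_right : sympForm a (b + c) = sympForm a b + sympForm a c := by
  rw [sympForm_comm, sympForm_add_left, sympForm_comm b, sympForm_comm c]

@[simp] theorem sympForm_self : sympForm a a = 0 := by
  simp only [sympForm]
  exact CharTwo.add_self_eq_zero _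

@[simp] theorem sympForm_smul_left (r : ZMod 2) : sympForm (r • a) b = r * sympForm a b := by
  simp only [sympForm, Prod.smul_fst, Prod.smul_snd, smul_dotProduct, dotProduct_smul, smul_eq_mul]
  ring

@[simp] theorem sympForm_smul_right (r : ZMod 2) : sympForm a (r • b) = r * sympForm a b := by
  rw [sympForm_comm, sympForm_smul_left, sympForm_comm]

@[simp] theorem sympForm_zero_left : sympForm 0 b = 0 := by simp [sympForm]

@[simp] theorem sympForm_zero_right : sympForm a 0 = 0 := by simp [sympForm]

theorem arfVec_add : arfVec (a + b) = arfVec a + arfVec b + sympForm a b := by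
  simp only [arfVec, sympForm, Prod.fst_add, Prod.snd_add, add_dotProduct, dotProduct_add]
  rw [dotProduct_comm b.1 a.2, dotProduct_comm a.2 b.1]
  ring

theorem sympSpace_add_self : a + a = 0 :=
  Prod.ext (funext fun _ => CharTwo.add_self_eq_zero _) (funext fun _ => CharTwo.add_self_eq_zero _)

theorem arfDiff_eq : arfDiff a b = arfVec b + sympForm a b := by
  rw [arfDiff, arfVec_add]
  grind

theorem arfDiff_add : arfDiff a (b + c) = arfDiff a b + arfDiff a c + sympForm b c := by
  simp only [arfDiff_eq, arfVec_add, sympForm_add_right]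
  ring

theorem arfDiff_zero : arfDiff a 0 = 0 := by simp [arfDiff_eq, arfVec]

theorem arfDiff_smul (r : ZMod 2) : arfDiff a (r • b) = r * arfDiff a b := by
  rcases (by decide +revert : r = 0 ∨ r = 1) with rfl | rfl
  · simp [arfDiff_zero]
  · simp

variable {a} in
theorem exists_sympForm_eq_one (ha : a ≠ 0) : ∃ t, sympForm t a = 1 := by
  have one : ∀ x : ZMod 2, x ≠ 0 → x = 1 := by decide
  by_cases h1 : a.1 = 0
  · have h2 : a.2 ≠ 0 := fun h2 => ha (Prod.ext h1 h2)
    obtain ⟨i, hi⟩ := Function.ne_iff.1 h2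
    exact ⟨basisE i, by simpa [sympForm, basisE] using one _ hi⟩
  · obtain ⟨i, hi⟩ := Function.ne_iff.1 h1
    exact ⟨basisF i, by simpa [sympForm, basisF] using one _ hi⟩

end sympForm

theorem ZMod.two_eq_one_of_ne_zero : ∀ x : ZMod 2, x ≠ 0 → x = 1 := by decide

/-- Six vectors with nondegenerate Gram matrix form a basis. -/
theorem bijective_comb_of_gram {b : Fin 6 → SympSpace 3}
    (h : ∀ α : Fin 6 → ZMod 2, (∀ j, ∑ i, α i * sympForm (b i) (b j) = 0) → α = 0) :
    Function.Bijective fun α : Fin 6 → ZMod 2 => ∑ i, α i • b i := by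
  have hc : Fintype.card (Fin 6 → ZMod 2) = Fintype.card (SympSpace 3) := by
    simp [ZMod.card]
  rw [Fintype.bijective_iff_injective_and_card]
  refine ⟨fun α β hαβ => ?_, hc⟩
  refine sub_eq_zero.1 (h _ fun j => ?_)
  have := congrArg (fun v => sympForm v (b j)) hαβ
  simp only [Fin.sum_univ_six, sympForm_add_left, sympForm_smul_left, Pi.sub_apply] at this ⊢
  linear_combination this

/-- The values of `arfDiff` on a combination of six vectors. -/
theorem arfDiff_comb (m : SympSpace 3) (b : Fin 6 → SympSpace 3) (α : Fin 6 → ZMod 2) :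
    arfDiff m (∑ i, α i • b i) = ∑ i, α i * arfDiff m (b i) +
      ∑ i, ∑ j with i < j, α i * α j * sympForm (b i) (b j) := by
  simp only [Fin.sum_univ_six, arfDiff_add, arfDiff_smul, sympForm_add_left, sympForm_smul_left,
    sympForm_smul_right, Finset.sum_filter]
  simp +decide
  ring

/-! ### Azygetic bases of `𝔽₂⁶`. -/

/-- Six vectors which together with `0` form an azygetic family of zeros of `arfDiff m`. -/
structure IsAzygeticBasis (m : SympSpace 3) (u : Fin 6 → SympSpace 3) : Prop where
  zero : ∀ i, arfDiff m (u i) = 0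
  one : ∀ i j, i ≠ j → sympForm (u i) (u j) = 1

theorem IsAzygeticBasis.sympForm_comb {m : SympSpace 3} {u : Fin 6 → SympSpace 3}
    (hu : IsAzygeticBasis m u) (α : Fin 6 → ZMod 2) (j : Fin 6) :
    sympForm (∑ i, α i • u i) (u j) = ∑ i, α i + α j := by
  have h : ∀ i j, sympForm (u i) (u j) = if i = j then 0 else 1 := fun i j => by
    split_ifs with hij
    · rw [hij, sympForm_self]
    · exact hu.one i j hij
  simp only [Fin.sum_univ_six, sympForm_add_left, sympForm_smul_left, h]
  fin_cases j <;> simp <;> grind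

/-- The Gram matrix has `0` on the diagonal and `1` elsewhere. A kernel vector has every coordinate
equal to the sum `σ` of all six, and then `σ = 6σ = 0`. -/
theorem IsAzygeticBasis.bijective {m : SympSpace 3} {u : Fin 6 → SympSpace 3}
    (hu : IsAzygeticBasis m u) :
    Function.Bijective fun α : Fin 6 → ZMod 2 => ∑ i, α i • u i := by
  refine bijective_comb_of_gram fun α h => ?_
  have h1 : ∀ j, ∑ i, α i + α j = 0 := fun j => by
    rw [← hu.sympForm_comb, ← h j]
    simp [Fin.sum_univ_six]
  simp only [Fin.sum_univ_six] at h1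
  have := h1 0
  have := h1 1
  have := h1 2
  have := h1 3
  have := h1 4
  have := h1 5
  funext j
  fin_cases j <;> simp <;> grind

theorem IsAzygeticBasis.arfDiff_comb {m : SympSpace 3} {u : Fin 6 → SympSpace 3}
    (hu : IsAzygeticBasis m u) (α : Fin 6 → ZMod 2) :
    arfDiff m (∑ i, α i • u i) = ∑ i, ∑ j with i < j, α i * α j := by
  rw [_root_.arfDiff_comb]
  simp only [hu.zero, mul_zero, Finset.sum_const_zero, zero_add]
  refine Finset.sum_congr rfl fun i _ => Finset.sum_congr rfl fun j hj => ?_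
  rw [hu.one i j (Finset.mem_filter.1 hj).2.ne, mul_one]

/-- The vectors `a` with `a` orthogonal to `u₀ + u₁ + u₂`, isotropic and with equal products with
`u₃, u₄, u₅`. -/
theorem IsAzygeticBasis.eq_of_orthogonal {m : SympSpace 3} {u : Fin 6 → SympSpace 3}
    (hu : IsAzygeticBasis m u) {a : SympSpace 3} (h0 : arfDiff m a = 0)
    (h1 : sympForm a (u 0 + u 1 + u 2) = 0) (h2 : sympForm a (u 3) = sympForm a (u 4))
    (h3 : sympForm a (u 4) = sympForm a (u 5)) :
    a = 0 ∨ a = u 0 ∨ a = u 1 ∨ a = u 2 := by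
  obtain ⟨α, rfl⟩ := hu.bijective.2 a
  dsimp only at h0 h1 h2 h3 ⊢
  simp only [sympForm_add_right, hu.sympForm_comb, hu.arfDiff_comb] at h0 h1 h2 h3
  have key : ∀ α : Fin 6 → ZMod 2, ∑ i, ∑ j with i < j, α i * α j = 0 →
      ∑ i, α i + α 0 + (∑ i, α i + α 1) + (∑ i, α i + α 2) = 0 →
      ∑ i, α i + α 3 = ∑ i, α i + α 4 → ∑ i, α i + α 4 = ∑ i, α i + α 5 →
      α = 0 ∨ α = Pi.single 0 1 ∨ α = Pi.single 1 1 ∨ α = Pi.single 2 1 := by decide +kernel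
  rcases key α h0 h1 h2 h3 with rfl | rfl | rfl | rfl <;> simp [Pi.single_apply]

/-- The vectors completing `0, u₀, u₁, u₂` to an azygetic quintuple. -/
theorem IsAzygeticBasis.eq_of_completing {m : SympSpace 3} {u : Fin 6 → SympSpace 3}
    (hu : IsAzygeticBasis m u) {a : SympSpace 3} (h0 : arfDiff m a = 0)
    (h1 : sympForm a (u 0) = 1) (h2 : sympForm a (u 1) = 1) (h3 : sympForm a (u 2) = 1) :
    ∃ i : Fin 6, a = ![u 3, u 4, u 5, u 3 + (u 0 + u 1 + u 2), u 4 + (u 0 + u 1 + u 2),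
      u 5 + (u 0 + u 1 + u 2)] i := by
  obtain ⟨α, rfl⟩ := hu.bijective.2 a
  dsimp only at h0 h1 h2 h3 ⊢
  simp only [hu.sympForm_comb, hu.arfDiff_comb] at h0 h1 h2 h3
  have key : ∀ α : Fin 6 → ZMod 2, ∑ i, ∑ j with i < j, α i * α j = 0 →
      ∑ i, α i + α 0 = 1 → ∑ i, α i + α 1 = 1 → ∑ i, α i + α 2 = 1 →
      ∃ i : Fin 6, ∀ j, α j = (![![0, 0, 0, 1, 0, 0], ![0, 0, 0, 0, 1, 0], ![0, 0, 0, 0, 0, 1],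
        ![1, 1, 1, 1, 0, 0], ![1, 1, 1, 0, 1, 0], ![1, 1, 1, 0, 0, 1]] : Fin 6 → Fin 6 → ZMod 2) i j := by
    decide +kernel
  obtain ⟨i, hi⟩ := key α h0 h1 h2 h3
  obtain rfl := funext hi
  refine ⟨i, ?_⟩
  fin_cases i <;> simp [Fin.sum_univ_six] <;> abel

theorem card_arfVec_eq_one :
    (Finset.univ.filter fun a : SympSpace 3 => arfVec a = 1).card = 28 := by
  unfold arfVec
  decide +kernel

theorem card_arfDiff_eq_zero {m : SympSpace 3} (hm : arfVec m = 1) :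
    (Finset.univ.filter fun a : SympSpace 3 => arfDiff m a = 0).card = 28 := by
  rw [← card_arfVec_eq_one]
  refine Finset.card_bijective (m + ·) (AddGroup.addLeft_bijective m) fun a => ?_
  simp only [Finset.mem_filter, Finset.mem_univ, true_and, arfDiff, hm]
  generalize arfVec (m + a) = x
  decide +revert

/-- Three vectors which together with `0` form an azygetic family of zeros of `arfDiff m` extend to
a family of six. -/
theorem exists_isAzygeticBasis {m : SympSpace 3} (hm : arfVec m = 1) {u₀ u₁ u₂ : SympSpace 3}
    (h0 : arfDiff m u₀ = 0) (h1 : arfDiff m u₁ = 0) (h2 : arfDiff m u₂ = 0)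
    (h01 : sympForm u₀ u₁ = 1) (h02 : sympForm u₀ u₂ = 1) (h12 : sympForm u₁ u₂ = 1) :
    ∃ u₃ u₄ u₅, IsAzygeticBasis m ![u₀, u₁, u₂, u₃, u₄, u₅] := by
  have h10 : sympForm u₁ u₀ = 1 := by rw [sympForm_comm, h01]
  have h20 : sympForm u₂ u₀ = 1 := by rw [sympForm_comm, h02]
  have h21 : sympForm u₂ u₁ = 1 := by rw [sympForm_comm, h12]
  obtain ⟨r, hr⟩ : ∃ r, r = u₀ + u₁ + u₂ := ⟨_, rfl⟩
  have hr1 : arfDiff m r = 1 := by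
    rw [hr]
    simp only [arfDiff_add, sympForm_add_left, h0, h1, h2, h01, h02, h12]
    rfl
  have hr0 : r ≠ 0 := by
    rintro rfl
    simp [arfDiff_zero] at hr1
  -- Start from a vector with product `1` with `r`. Multiples of `u₀` and `u₁` correct the products
  -- with `u₁` and `u₀`, and orthogonality of `u₀, u₁` to `r` then forces the product with `u₂`.
  obtain ⟨v, hv0, hv1, hv2⟩ : ∃ v, sympForm v u₀ = 1 ∧ sympForm v u₁ = 1 ∧ sympForm v u₂ = 1 := by
    obtain ⟨v, hv⟩ := exists_sympForm_eq_one hr0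
    refine ⟨v + (1 + sympForm v u₁) • u₀ + (1 + sympForm v u₀) • u₁, ?_, ?_, ?_⟩ <;>
      rw [hr] at hv <;>
      simp only [sympForm_add_left, sympForm_smul_left, sympForm_add_right, sympForm_self, h01,
        h02, h12, h10] at hv ⊢ <;> grind
  have h0v : sympForm u₀ v = 1 := by rw [sympForm_comm, hv0]
  have h1v : sympForm u₁ v = 1 := by rw [sympForm_comm, hv1]
  have h2v : sympForm u₂ v = 1 := by rw [sympForm_comm, hv2]
  -- Pigeonhole: `64` vectors and only `16` possible quadruples of products. The vectors `s` and `t`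
  -- will span the hyperbolic plane orthogonal to `u₀, u₁, u₂, v`.
  obtain ⟨s, hs0, hs⟩ : ∃ s : SympSpace 3, s ≠ 0 ∧ (sympForm s u₀ = 0 ∧ sympForm s u₁ = 0 ∧
      sympForm s u₂ = 0 ∧ sympForm s v = 0) := by
    obtain ⟨a, b, hab, he⟩ := Fintype.exists_ne_map_eq_of_card_lt
      (fun a : SympSpace 3 => (sympForm a u₀, sympForm a u₁, sympForm a u₂, sympForm a v))
      (by simp [ZMod.card])
    simp only [Prod.mk.injEq] at he
    refine ⟨a + b, fun h => hab ?_, ?_⟩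
    · rw [← add_zero a, ← sympSpace_add_self b, ← add_assoc, h, zero_add]
    · simp only [sympForm_add_left, he]
      exact ⟨CharTwo.add_self_eq_zero _, CharTwo.add_self_eq_zero _, CharTwo.add_self_eq_zero _,
        CharTwo.add_self_eq_zero _⟩
  obtain ⟨hs0', hs1', hs2', hsv⟩ := hs
  have h0s : sympForm u₀ s = 0 := by rw [sympForm_comm, hs0']
  have h1s : sympForm u₁ s = 0 := by rw [sympForm_comm, hs1']
  have h2s : sympForm u₂ s = 0 := by rw [sympForm_comm, hs2']
  have hvs : sympForm v s = 0 := by rw [sympForm_comm, hsv]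
  obtain ⟨t, hts, ht0, ht1, ht2, htv⟩ : ∃ t, sympForm t s = 1 ∧ sympForm t u₀ = 0 ∧
      sympForm t u₁ = 0 ∧ sympForm t u₂ = 0 ∧ sympForm t v = 0 := by
    obtain ⟨t, ht⟩ := exists_sympForm_eq_one hs0
    obtain ⟨x, hx⟩ : ∃ x, x = sympForm t u₀ + sympForm t u₁ + sympForm t u₂ + sympForm t v :=
      ⟨_, rfl⟩
    -- Orthogonal projection away from `u₀, u₁, u₂, v`. Their Gram matrix (`0` on the diagonal, `1`
    -- elsewhere, size `4`) is its own inverse, which gives these coefficients.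
    refine ⟨t + (x + sympForm t u₀) • u₀ + (x + sympForm t u₁) • u₁ + (x + sympForm t u₂) • u₂ +
      (x + sympForm t v) • v, ?_, ?_, ?_, ?_, ?_⟩ <;>
      simp only [sympForm_add_left, sympForm_smul_left, sympForm_self, h01, h02, h12, h10, h20, h21,
        hv0, hv1, hv2, h0v, h1v, h2v, ht, h0s, h1s, h2s, hvs] <;> grind
  have hst : sympForm s t = 1 := by rw [sympForm_comm, hts]
  have h0t : sympForm u₀ t = 0 := by rw [sympForm_comm, ht0]
  have h1t : sympForm u₁ t = 0 := by rw [sympForm_comm, ht1]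
  have h2t : sympForm u₂ t = 0 := by rw [sympForm_comm, ht2]
  have hvt : sympForm v t = 0 := by rw [sympForm_comm, htv]
  have hbij : Function.Bijective fun α : Fin 6 → ZMod 2 =>
      ∑ i, α i • (![u₀, u₁, u₂, v, s, t] : Fin 6 → SympSpace 3) i := by
    refine bijective_comb_of_gram fun α h => ?_
    have e0 := h 0
    have e1 := h 1
    have e2 := h 2
    have e3 := h 3
    have e4 := h 4
    have e5 := h 5
    simp only [Fin.sum_univ_six, cons_val, sympForm_self, h01, h02, h12, h10, h20, h21, hv0, hv1,
      hv2, h0v, h1v, h2v, hs0', hs1', hs2', hsv, h0s, h1s, h2s, hvs, ht0, ht1, ht2, htv, h0t, h1t,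
      h2t, hvt, hst, hts] at e0 e1 e2 e3 e4 e5
    funext j
    fin_cases j <;> simp <;> grind
  -- The oddness of `m` enters here through a count: `arfDiff m` has `28` zeros, and in the basis
  -- `u₀, u₁, u₂, v, s, t` this number of zeros occurs only if the stated product relation holds.
  have hcount : arfDiff m v = arfDiff m s * arfDiff m t := by
    have key : ∀ n l k : ZMod 2, (Finset.univ.filter fun α : Fin 6 → ZMod 2 =>
        α 0 * α 1 + α 0 * α 2 + α 1 * α 2 + (α 0 + α 1 + α 2 + n) * α 3 + l * α 4 + k * α 5 +
          α 4 * α 5 = 0).card = 28 → n = l * k := by decide +kernel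
    apply key
    rw [← card_arfDiff_eq_zero hm]
    refine Finset.card_bijective _ hbij fun α => ?_
    simp only [Finset.mem_filter, Finset.mem_univ, true_and]
    have : arfDiff m (∑ i, α i • (![u₀, u₁, u₂, v, s, t] : Fin 6 → SympSpace 3) i) =
        α 0 * α 1 + α 0 * α 2 + α 1 * α 2 + (α 0 + α 1 + α 2 + arfDiff m v) * α 3 +
          arfDiff m s * α 4 + arfDiff m t * α 5 + α 4 * α 5 := by
      simp only [Fin.sum_univ_six, cons_val, arfDiff_add, arfDiff_smul, sympForm_add_left,
        sympForm_smul_left, sympForm_smul_right, h0, h1, h2, h01, h02, h12, h0v, h1v, h2v, h0s, h1s,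
        h2s, hvs, h0t, h1t, h2t, hvt, hst]
      ring
    rw [this]
  have hvr : sympForm v r = 1 := by
    rw [hr, sympForm_add_right, sympForm_add_right, hv0, hv1, hv2]
    rfl
  have hsr : sympForm s r = 0 := by simp [hr, hs0', hs1', hs2']
  have htr : sympForm t r = 0 := by simp [hr, ht0, ht1, ht2]
  have h0r : sympForm u₀ r = 0 := by
    rw [hr, sympForm_add_right, sympForm_add_right, sympForm_self, h01, h02]
    rfl
  have h1r : sympForm u₁ r = 0 := by
    rw [hr, sympForm_add_right, sympForm_add_right, sympForm_self, h10, h12]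
    rfl
  have h2r : sympForm u₂ r = 0 := by
    rw [hr, sympForm_add_right, sympForm_add_right, sympForm_self, h20, h21]
    rfl
  have hrv : sympForm r v = 1 := by rw [sympForm_comm, hvr]
  have hrs : sympForm r s = 0 := by rw [sympForm_comm, hsr]
  have hrt : sympForm r t = 0 := by rw [sympForm_comm, htr]
  have hr0' : sympForm r u₀ = 0 := by rw [sympForm_comm, h0r]
  have hr1' : sympForm r u₁ = 0 := by rw [sympForm_comm, h1r]
  have hr2' : sympForm r u₂ = 0 := by rw [sympForm_comm, h2r]
  -- By `hcount` the first vector is a zero of `arfDiff m`. The other two move it by `s` and by `t`.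
  -- Since `r` is orthogonal to `u₀, u₁, u₂, s, t` and has product `1` with `v`, its multiples
  -- repair the mutual products. Since `arfDiff m r = 1`, they also repair the values.
  refine ⟨v + arfDiff m t • s + arfDiff m s • t,
    v + (arfDiff m t + 1) • s + arfDiff m s • t + (1 + arfDiff m s) • r,
    v + arfDiff m t • s + (arfDiff m s + 1) • t + (1 + arfDiff m t) • r, ?_, ?_⟩
  · intro i
    fin_cases i
    · exact h0
    · exact h1
    · exact h2
    all_goals
      simp only [Fin.reduceFinMk, cons_val, arfDiff_add, arfDiff_smul, sympForm_add_left,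
        sympForm_smul_left, sympForm_smul_right, hr1, hcount, hvs,
        hvt, hst, hvr, hsr, htr]
      generalize arfDiff m s = l
      generalize arfDiff m t = k
      decide +revert
  · intro i j hij
    fin_cases i <;> fin_cases j <;> first | exact absurd rfl hij | skip
    all_goals
      simp only [Fin.reduceFinMk, Fin.zero_eta, Fin.mk_one, cons_val, sympForm_add_left,
        sympForm_add_right, sympForm_smul_left,
        sympForm_smul_right, sympForm_self, h01, h02, h12, h10, h20, h21, hv0, hv1, hv2, h0v, h1v,
        h2v, hs0', hs1', hs2', hsv, h0s, h1s, h2s, hvs, ht0, ht1, ht2, htv, h0t, h1t, h2t, hvt, hst,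
        hts, hvr, hsr, htr, hrv, hrs, hrt, hr0', hr1', hr2', h0r, h1r, h2r]
    all_goals
      try
        generalize arfDiff m s = l
        generalize arfDiff m t = k
        decide +revert

/-! ### From quadratic forms to coordinate vectors. -/

/-- The coordinates `(q(eᵢ), q(fᵢ))` of a quadratic form. -/
def formCoords {g : ℕ} (q : QuadraticForm (ZMod 2) (SympSpace g)) : SympSpace g :=
  (fun i => q (basisE i), fun i => q (basisF i))

theorem arf_eq_arfVec {g : ℕ} (q : QuadraticForm (ZMod 2) (SympSpace g)) :
    arf q = arfVec (formCoords q) := rfl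

theorem formCoords_add {g : ℕ} (p q : QuadraticForm (ZMod 2) (SympSpace g)) :
    formCoords (p + q) = formCoords p + formCoords q := rfl

/-- Two forms with the same polar form differ by an additive map, which is determined on the
symplectic basis. -/
theorem formCoords_injective {g : ℕ} :
    Function.Injective fun q : SympQuadForm g => formCoords q.1 := by
  intro p q h
  let D : SympSpace g →+ ZMod 2 :=
    { toFun := fun v => p.1 v - q.1 v
      map_zero' := by simp
      map_add' := fun v w => by
        have hp := p.2 v w
        have hq := q.2 v w
        rw [QuadraticMap.polar] at hp hq
        linear_combination hp - hq }
  have hD : D.toZModLinearMap 2 = 0 := by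
    ext i
    · exact sub_eq_zero.2 (congrFun (congrArg Prod.fst h) i)
    · exact sub_eq_zero.2 (congrFun (congrArg Prod.snd h) i)
  refine Subtype.ext (QuadraticMap.ext fun v => sub_eq_zero.1 ?_)
  exact LinearMap.congr_fun hD v

/-- The bilinear form whose diagonal is the quadratic form with coordinates `m`. -/
def coordsBilin {g : ℕ} (m : SympSpace g) : LinearMap.BilinMap (ZMod 2) (SympSpace g) (ZMod 2) :=
  LinearMap.mk₂ (ZMod 2)
    (fun v w => v.1 ⬝ᵥ w.2 + ∑ i, v.1 i * m.1 i * w.1 i + ∑ i, v.2 i * m.2 i * w.2 i)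
    (fun v v' w => by
      simp only [Prod.fst_add, Prod.snd_add, add_dotProduct, Pi.add_apply, add_mul,
        Finset.sum_add_distrib]
      ring)
    (fun r v w => by
      simp only [Prod.smul_fst, Prod.smul_snd, smul_dotProduct, Pi.smul_apply, smul_eq_mul,
        mul_add, Finset.mul_sum, mul_assoc])
    (fun v w w' => by
      simp only [Prod.fst_add, Prod.snd_add, dotProduct_add, Pi.add_apply, mul_add,
        Finset.sum_add_distrib]
      ring)
    (fun r v w => by
      simp only [Prod.smul_fst, Prod.smul_snd, dotProduct_smul, Pi.smul_apply, smul_eq_mul,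
        mul_add, Finset.mul_sum]
      congr 1 <;> [congr 1; skip] <;> refine Finset.sum_congr rfl fun i _ => by ring)

theorem formCoords_surjective {g : ℕ} :
    Function.Surjective fun q : SympQuadForm g => formCoords q.1 := by
  intro m
  refine ⟨⟨(coordsBilin m).toQuadraticMap, fun v w => ?_⟩, ?_⟩
  · rw [LinearMap.BilinMap.polar_toQuadraticMap]
    simp only [coordsBilin, LinearMap.mk₂_apply, sympForm]
    have h1 : ∑ i, w.1 i * m.1 i * v.1 i = ∑ i, v.1 i * m.1 i * w.1 i :=
      Finset.sum_congr rfl fun i _ => by ring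
    have h2 : ∑ i, w.2 i * m.2 i * v.2 i = ∑ i, v.2 i * m.2 i * w.2 i :=
      Finset.sum_congr rfl fun i _ => by ring
    rw [h1, h2]
    grind
  · refine Prod.ext (funext fun i => ?_) (funext fun i => ?_)
    · simp [formCoords, coordsBilin, basisE, Pi.single_apply]
    · simp [formCoords, coordsBilin, basisF, Pi.single_apply]

theorem isAzygeticTriple_iff {g : ℕ} (p q r : SympQuadForm g) :
    IsAzygeticTriple p q r ↔
      sympForm (formCoords p.1 + formCoords q.1) (formCoords p.1 + formCoords r.1) = 1 := by
  simp only [IsAzygeticTriple, arf_eq_arfVec, formCoords_add, arfVec_add, sympForm_add_left,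
    sympForm_add_right, sympForm_self]
  rw [sympForm_comm (formCoords q.1) (formCoords p.1)]
  constructor <;> intro h <;> grind

/-- Triples through a fixed member suffice: by the identity `key`, the invariant of any triple is
the sum of those of the three triples that replace one entry by the base point, and `1 + 1 + 1 = 1`.
-/
theorem isAzygetic_succ_iff {g n : ℕ} (q : Fin (n + 1) → SympQuadForm g) :
    IsAzygetic q ↔ ∀ i j : Fin n, i ≠ j →
      sympForm (formCoords (q 0).1 + formCoords (q i.succ).1)
        (formCoords (q 0).1 + formCoords (q j.succ).1) = 1 := by
  constructor
  · intro h i j hij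
    exact (isAzygeticTriple_iff _ _ _).1 (h 0 i.succ j.succ (Fin.succ_ne_zero i).symm
      (Fin.succ_ne_zero j).symm ((Fin.succ_injective n).ne hij))
  · intro h i j k hij hik hjk
    rw [isAzygeticTriple_iff]
    have key : ∀ a b c d : SympSpace g, sympForm (a + b) (a + c) =
        sympForm (d + a) (d + b) + sympForm (d + a) (d + c) + sympForm (d + b) (d + c) := by
      intro a b c d
      simp only [sympForm_add_left, sympForm_add_right, sympForm_self]
      rw [sympForm_comm a d, sympForm_comm b a, sympForm_comm b d]
      grind
    rw [key _ _ _ (formCoords (q 0).1)]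
    induction i using Fin.cases with
    | zero =>
      induction j using Fin.cases with
      | zero => exact absurd rfl hij
      | succ j =>
        induction k using Fin.cases with
        | zero => exact absurd rfl hik
        | succ k =>
          rw [h j k (fun e => hjk (by rw [e])), sympSpace_add_self]
          simp
    | succ i =>
      induction j using Fin.cases with
      | zero =>
        induction k using Fin.cases with
        | zero => exact absurd rfl hjk
        | succ k =>
          rw [h i k (fun e => hik (by rw [e])), sympSpace_add_self]
          simp
      | succ j =>
        induction k using Fin.cases with
        | zero =>
          rw [h i j (fun e => hij (by rw [e])), sympSpace_add_self]
          simp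
        | succ k =>
          rw [h i j (fun e => hij (by rw [e])), h i k (fun e => hik (by rw [e])),
            h j k (fun e => hjk (by rw [e]))]
          rfl

theorem arfDiff_add_eq_zero_iff {g : ℕ} {m a : SympSpace g} (hm : arfVec m = 1) :
    arfDiff m (m + a) = 0 ↔ arfVec a = 1 := by
  rw [arfDiff, ← add_assoc, sympSpace_add_self, zero_add, hm]
  generalize arfVec a = x
  decide +revert

theorem isAronhold_iff {q₁ : SympQuadForm 3} (h₁ : IsOddForm q₁) (q : Fin 6 → SympQuadForm 3) :
    IsAronhold (Fin.cons q₁ q : Fin 7 → SympQuadForm 3) ↔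
      IsAzygeticBasis (formCoords q₁.1) fun i => formCoords q₁.1 + formCoords (q i).1 := by
  have h₁' : arfVec (formCoords q₁.1) = 1 := h₁
  rw [IsAronhold, isAzygetic_succ_iff]
  simp only [Fin.cons_zero, Fin.cons_succ]
  constructor
  · rintro ⟨ho, ha⟩
    exact ⟨fun i => (arfDiff_add_eq_zero_iff h₁').2 (ho i.succ), ha⟩
  · rintro ⟨ho, ha⟩
    refine ⟨fun i => ?_, ha⟩
    induction i using Fin.cases with
    | zero => exact h₁
    | succ i => exact (arfDiff_add_eq_zero_iff h₁').1 (ho i)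

theorem formCoords_eq_of_add_eq {g : ℕ} {m a b : SympSpace g} (h : m + a = b) : a = m + b := by
  rw [← h, ← add_assoc, sympSpace_add_self, zero_add]

/-! ### Counting the completions. -/

/-- The Gram matrix of the six vectors completing an azygetic quadruple to a quintuple. -/
theorem IsAzygeticBasis.sympForm_completing {m : SympSpace 3} {u : Fin 6 → SympSpace 3}
    (hu : IsAzygeticBasis m u) (i j : Fin 6) :
    sympForm (![u 3, u 4, u 5, u 3 + (u 0 + u 1 + u 2), u 4 + (u 0 + u 1 + u 2),
      u 5 + (u 0 + u 1 + u 2)] i) (![u 3, u 4, u 5, u 3 + (u 0 + u 1 + u 2),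
      u 4 + (u 0 + u 1 + u 2), u 5 + (u 0 + u 1 + u 2)] j) = 1 ↔
    i ≠ j ∧ ((i < 3 ↔ j < 3) ∨ i = j + 3) := by
  have h : ∀ i j, sympForm (u i) (u j) = if i = j then 0 else 1 := fun i j => by
    split_ifs with hij
    · rw [hij, sympForm_self]
    · exact hu.one i j hij
  fin_cases i <;> fin_cases j <;>
    simp only [Fin.reduceFinMk, Fin.zero_eta, Fin.mk_one, cons_val, sympForm_add_left,
      sympForm_add_right, h] <;> decide

/-- Distinct vertices of the triangular prism have distinct sets of neighbours. -/
theorem IsAzygeticBasis.completing_injective {m : SympSpace 3} {u : Fin 6 → SympSpace 3}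
    (hu : IsAzygeticBasis m u) :
    Function.Injective ![u 3, u 4, u 5, u 3 + (u 0 + u 1 + u 2), u 4 + (u 0 + u 1 + u 2),
      u 5 + (u 0 + u 1 + u 2)] := by
  intro i j hij
  have h : ∀ k, (i ≠ k ∧ ((i < 3 ↔ k < 3) ∨ i = k + 3)) ↔
      (j ≠ k ∧ ((j < 3 ↔ k < 3) ∨ j = k + 3)) := fun k => by
    rw [← hu.sympForm_completing i k, ← hu.sympForm_completing j k, hij]
  revert h
  revert i j
  have : ∀ i j : Fin 6, (∀ k, (i ≠ k ∧ ((i < 3 ↔ k < 3) ∨ i = k + 3)) ↔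
      (j ≠ k ∧ ((j < 3 ↔ k < 3) ∨ j = k + 3))) → i = j := by decide
  exact fun i j _ => this i j

theorem IsAzygeticBasis.arfDiff_completing {m : SympSpace 3} {u : Fin 6 → SympSpace 3}
    (hu : IsAzygeticBasis m u) (i : Fin 6) :
    arfDiff m (![u 3, u 4, u 5, u 3 + (u 0 + u 1 + u 2), u 4 + (u 0 + u 1 + u 2),
      u 5 + (u 0 + u 1 + u 2)] i) = 0 := by
  have h : ∀ i j, sympForm (u i) (u j) = if i = j then 0 else 1 := fun i j => by
    split_ifs with hij
    · rw [hij, sympForm_self]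
    · exact hu.one i j hij
  fin_cases i <;>
    simp only [Fin.reduceFinMk, Fin.zero_eta, Fin.mk_one, cons_val, arfDiff_add, hu.zero,
      sympForm_add_left, sympForm_add_right, h] <;> decide

theorem IsAzygeticBasis.sympForm_completing_left {m : SympSpace 3} {u : Fin 6 → SympSpace 3}
    (hu : IsAzygeticBasis m u) (i : Fin 6) (j : Fin 6) (hj : j < 3) :
    sympForm (![u 3, u 4, u 5, u 3 + (u 0 + u 1 + u 2), u 4 + (u 0 + u 1 + u 2),
      u 5 + (u 0 + u 1 + u 2)] i) (u j) = 1 := by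
  have h : ∀ i j, sympForm (u i) (u j) = if i = j then 0 else 1 := fun i j => by
    split_ifs with hij
    · rw [hij, sympForm_self]
    · exact hu.one i j hij
  fin_cases i <;> fin_cases j <;> first | exact absurd hj (by decide) | skip
  all_goals
    simp only [Fin.reduceFinMk, Fin.zero_eta, Fin.mk_one, cons_val, sympForm_add_left, h]
    decide

-- The triangles of the prism are its two end faces, since its remaining edges form a perfect
-- matching between them.
set_option synthInstance.maxSize 2000 in
theorem triple_completing_cases (i j k : Fin 6)
    (hij : i ≠ j ∧ ((i < 3 ↔ j < 3) ∨ i = j + 3)) (hik : i ≠ k ∧ ((i < 3 ↔ k < 3) ∨ i = k + 3))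
    (hjk : j ≠ k ∧ ((j < 3 ↔ k < 3) ∨ j = k + 3)) :
    ({i, j, k} : Finset (Fin 6)) = {0, 1, 2} ∨ ({i, j, k} : Finset (Fin 6)) = {3, 4, 5} := by
  decide +revert

theorem isAzygeticBasis_vec {m u₀ u₁ u₂ u₃ u₄ u₅ : SympSpace 3} (d0 : arfDiff m u₀ = 0)
    (d1 : arfDiff m u₁ = 0) (d2 : arfDiff m u₂ = 0) (d3 : arfDiff m u₃ = 0)
    (d4 : arfDiff m u₄ = 0) (d5 : arfDiff m u₅ = 0) (h01 : sympForm u₀ u₁ = 1)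
    (h02 : sympForm u₀ u₂ = 1) (h03 : sympForm u₀ u₃ = 1) (h04 : sympForm u₀ u₄ = 1)
    (h05 : sympForm u₀ u₅ = 1) (h12 : sympForm u₁ u₂ = 1) (h13 : sympForm u₁ u₃ = 1)
    (h14 : sympForm u₁ u₄ = 1) (h15 : sympForm u₁ u₅ = 1) (h23 : sympForm u₂ u₃ = 1)
    (h24 : sympForm u₂ u₄ = 1) (h25 : sympForm u₂ u₅ = 1) (h34 : sympForm u₃ u₄ = 1)
    (h35 : sympForm u₃ u₅ = 1) (h45 : sympForm u₄ u₅ = 1) :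
    IsAzygeticBasis m ![u₀, u₁, u₂, u₃, u₄, u₅] := by
  constructor
  · intro i
    fin_cases i <;>
      simp only [Fin.reduceFinMk, Fin.zero_eta, Fin.mk_one, cons_val, d0, d1, d2, d3, d4, d5]
  · have key : ∀ i j : Fin 6, i < j → sympForm ((![u₀, u₁, u₂, u₃, u₄, u₅] : Fin 6 → _) i)
        ((![u₀, u₁, u₂, u₃, u₄, u₅] : Fin 6 → _) j) = 1 := by
      intro i j hij
      fin_cases i <;> fin_cases j <;> first | exact absurd hij (by decide) | skip
      all_goals
        simp only [Fin.reduceFinMk, Fin.zero_eta, Fin.mk_one, cons_val, h01, h02, h03, h04, h05,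
          h12, h13, h14, h15, h23, h24, h25, h34, h35, h45]
    intro i j hij
    rcases lt_or_gt_of_ne hij with h | h
    · exact key i j h
    · rw [sympForm_comm]
      exact key j i h

theorem ncard_completions {q₁ q₂ q₃ q₄ : SympQuadForm 3} (h₁ : IsOddForm q₁) (h₂ : IsOddForm q₂)
    (h₃ : IsOddForm q₃) (h₄ : IsOddForm q₄) (hazy : IsAzygetic ![q₁, q₂, q₃, q₄]) :
    {T : Set (SympQuadForm 3) | ∃ q₅ q₆ q₇, T = {q₅, q₆, q₇} ∧
        IsAronhold ![q₁, q₂, q₃, q₄, q₅, q₆, q₇]}.ncard = 2 := by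
  have hm : arfVec (formCoords q₁.1) = 1 := h₁
  obtain ⟨m, hmdef⟩ : ∃ m, m = formCoords q₁.1 := ⟨_, rfl⟩
  rw [← hmdef] at hm
  have hA : ∀ q₅ q₆ q₇ : SympQuadForm 3, IsAronhold ![q₁, q₂, q₃, q₄, q₅, q₆, q₇] ↔
      IsAzygeticBasis m ![m + formCoords q₂.1, m + formCoords q₃.1, m + formCoords q₄.1,
        m + formCoords q₅.1, m + formCoords q₆.1, m + formCoords q₇.1] := by
    intro q₅ q₆ q₇
    have e : ![m + formCoords q₂.1, m + formCoords q₃.1, m + formCoords q₄.1,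
        m + formCoords q₅.1, m + formCoords q₆.1, m + formCoords q₇.1] =
        fun i => formCoords q₁.1 + formCoords ((![q₂, q₃, q₄, q₅, q₆, q₇] : Fin 6 → _) i).1 := by
      funext i
      rw [← hmdef]
      fin_cases i <;> rfl
    rw [e, hmdef]
    exact isAronhold_iff h₁ ![q₂, q₃, q₄, q₅, q₆, q₇]
  have hz := (isAzygetic_succ_iff ![q₁, q₂, q₃, q₄]).1 hazy
  have z01 := hz 0 1 (by decide)
  have z02 := hz 0 2 (by decide)
  have z12 := hz 1 2 (by decide)
  simp only [cons_val_zero, cons_val_succ, cons_val, ← hmdef] at z01 z02 z12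
  have d0 : arfDiff m (m + formCoords q₂.1) = 0 := (arfDiff_add_eq_zero_iff hm).2 h₂
  have d1 : arfDiff m (m + formCoords q₃.1) = 0 := (arfDiff_add_eq_zero_iff hm).2 h₃
  have d2 : arfDiff m (m + formCoords q₄.1) = 0 := (arfDiff_add_eq_zero_iff hm).2 h₄
  obtain ⟨u₃, u₄, u₅, hu⟩ := exists_isAzygeticBasis hm d0 d1 d2 z01 z02 z12
  obtain ⟨u, hudef⟩ : ∃ u : Fin 6 → SympSpace 3, u = ![m + formCoords q₂.1, m + formCoords q₃.1,
    m + formCoords q₄.1, u₃, u₄, u₅] := ⟨_, rfl⟩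
  rw [← hudef] at hu
  have hu0 : u 0 = m + formCoords q₂.1 := by rw [hudef]; rfl
  have hu1 : u 1 = m + formCoords q₃.1 := by rw [hudef]; rfl
  have hu2 : u 2 = m + formCoords q₄.1 := by rw [hudef]; rfl
  obtain ⟨w, hw⟩ : ∃ w : Fin 6 → SympSpace 3, w = ![u 3, u 4, u 5, u 3 + (u 0 + u 1 + u 2),
    u 4 + (u 0 + u 1 + u 2), u 5 + (u 0 + u 1 + u 2)] := ⟨_, rfl⟩
  have wgram := hu.sympForm_completing
  have winj := hu.completing_injective
  have wdiff := hu.arfDiff_completing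
  have wleft := hu.sympForm_completing_left
  have wall : ∀ {a : SympSpace 3}, _ → _ → _ → _ → _ := fun {a} => hu.eq_of_completing (a := a)
  rw [← hw] at wgram winj wdiff wleft wall
  choose P hP using fun i => formCoords_surjective (m + w i)
  have hPw : ∀ i, m + formCoords (P i).1 = w i := fun i => (formCoords_eq_of_add_eq (hP i).symm).symm
  have hPinj : Function.Injective P := fun i j hij =>
    winj (by rw [← hPw i, ← hPw j, hij])
  have hArP : ∀ i j k : Fin 6, sympForm (w i) (w j) = 1 → sympForm (w i) (w k) = 1 →
      sympForm (w j) (w k) = 1 → IsAronhold ![q₁, q₂, q₃, q₄, P i, P j, P k] := by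
    intro i j k hij hik hjk
    rw [hA, hPw, hPw, hPw]
    have wl0 := fun i => wleft i 0 (by decide)
    have wl1 := fun i => wleft i 1 (by decide)
    have wl2 := fun i => wleft i 2 (by decide)
    rw [hu0] at wl0
    rw [hu1] at wl1
    rw [hu2] at wl2
    exact isAzygeticBasis_vec d0 d1 d2 (wdiff i) (wdiff j) (wdiff k) z01 z02
      (by rw [sympForm_comm, wl0]) (by rw [sympForm_comm, wl0]) (by rw [sympForm_comm, wl0]) z12
      (by rw [sympForm_comm, wl1]) (by rw [sympForm_comm, wl1]) (by rw [sympForm_comm, wl1])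
      (by rw [sympForm_comm, wl2]) (by rw [sympForm_comm, wl2]) (by rw [sympForm_comm, wl2])
      hij hik hjk
  have hset : {T : Set (SympQuadForm 3) | ∃ q₅ q₆ q₇, T = {q₅, q₆, q₇} ∧
      IsAronhold ![q₁, q₂, q₃, q₄, q₅, q₆, q₇]} =
      {P '' (({0, 1, 2} : Finset (Fin 6)) : Set (Fin 6)),
        P '' (({3, 4, 5} : Finset (Fin 6)) : Set (Fin 6))} := by
    ext T
    simp only [Set.mem_ofPred_eq, Set.mem_insert_iff, Set.mem_singleton_iff]
    constructor
    · rintro ⟨q₅, q₆, q₇, rfl, hT⟩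
      rw [hA] at hT
      -- Each of the three added forms is one of the six candidates `P i`.
      have find : ∀ (q : SympQuadForm 3) (l : Fin 6), 2 < l →
          (![m + formCoords q₂.1, m + formCoords q₃.1, m + formCoords q₄.1, m + formCoords q₅.1,
            m + formCoords q₆.1, m + formCoords q₇.1] : Fin 6 → SympSpace 3) l =
            m + formCoords q.1 → ∃ i, q = P i := by
        intro q l hl hq
        have a0 := hT.zero l
        have a1 := hT.one l 0 (by rintro rfl; exact absurd hl (by decide))
        have a2 := hT.one l 1 (by rintro rfl; exact absurd hl (by decide))
        have a3 := hT.one l 2 (by rintro rfl; exact absurd hl (by decide))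
        rw [hq] at a0 a1 a2 a3
        obtain ⟨i, hi⟩ := wall a0 (by rw [hu0]; exact a1) (by rw [hu1]; exact a2)
          (by rw [hu2]; exact a3)
        refine ⟨i, formCoords_injective ?_⟩
        change formCoords q.1 = formCoords (P i).1
        rw [formCoords_eq_of_add_eq hi]
        exact (hP i).symm
      obtain ⟨i, rfl⟩ := find q₅ 3 (by decide) rfl
      obtain ⟨j, rfl⟩ := find q₆ 4 (by decide) rfl
      obtain ⟨k, rfl⟩ := find q₇ 5 (by decide) rfl
      have b1 := hT.one 3 4 (by decide)
      have b2 := hT.one 3 5 (by decide)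
      have b3 := hT.one 4 5 (by decide)
      simp only [cons_val, hPw, wgram] at b1 b2 b3
      have himg : ({P i, P j, P k} : Set (SympQuadForm 3)) =
          P '' (({i, j, k} : Finset (Fin 6)) : Set (Fin 6)) := by
        simp [Set.image_insert_eq]
      rw [himg]
      rcases triple_completing_cases i j k b1 b2 b3 with h | h <;> rw [h] <;> simp
    · rintro (rfl | rfl)
      · exact ⟨P 0, P 1, P 2, by simp [Set.image_insert_eq], hArP 0 1 2 ((wgram _ _).2 (by decide))
          ((wgram _ _).2 (by decide)) ((wgram _ _).2 (by decide))⟩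
      · exact ⟨P 3, P 4, P 5, by simp [Set.image_insert_eq], hArP 3 4 5 ((wgram _ _).2 (by decide))
          ((wgram _ _).2 (by decide)) ((wgram _ _).2 (by decide))⟩
  rw [hset, Set.ncard_pair]
  intro h
  have h' := Finset.coe_injective (hPinj.image_injective h)
  exact absurd h' (by decide)

/-! ### The differentiated theta formula. -/

/-- Reduction of a characteristic modulo `2`. -/
def modChar {g : ℕ} (b : ThetaChar g) : SympSpace g :=
  (fun i => (b.1 i : ZMod 2), fun i => (b.2 i : ZMod 2))

theorem modChar_add {g : ℕ} (a b : ThetaChar g) : modChar (a + b) = modChar a + modChar b := by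
  simp only [modChar, Prod.fst_add, Prod.snd_add, Pi.add_apply, Int.cast_add]
  rfl

theorem modChar_neg {g : ℕ} (a : ThetaChar g) : modChar (-a) = modChar a := by
  simp only [modChar, Prod.fst_neg, Prod.snd_neg, Pi.neg_apply, Int.cast_neg, ZMod.neg_eq_self_mod_two]

theorem modChar_sub {g : ℕ} (a b : ThetaChar g) : modChar (a - b) = modChar a + modChar b := by
  rw [sub_eq_add_neg, modChar_add, modChar_neg]

theorem modChar_liftChar {g : ℕ} (a : SympSpace g) : modChar (liftChar a) = a := by
  simp [modChar, liftChar]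

theorem modChar_char {g : ℕ} (q : SympQuadForm g) : modChar q.char = formCoords q.1 := by
  simp [modChar, SympQuadForm.char, formCoords]

theorem cast_dotProduct {g : ℕ} (a b : ThetaChar g) :
    ((a.1 ⬝ᵥ b.2 : ℤ) : ZMod 2) = (modChar a).1 ⬝ᵥ (modChar b).2 := by
  simp [dotProduct, modChar]

theorem eq_add_two_mul_of_modChar_eq {g : ℕ} {a b : ThetaChar g} (h : modChar a = modChar b) :
    ∃ n, a = b + 2 • n := by
  have h1 : ∀ i, ∃ n, a.1 i = b.1 i + 2 * n := fun i => by
    obtain ⟨n, hn⟩ := (ZMod.intCast_eq_intCast_iff_dvd_sub _ _ 2).1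
      (congrFun (congrArg Prod.fst h) i).symm
    exact ⟨n, by push_cast at hn; linarith⟩
  have h2 : ∀ i, ∃ n, a.2 i = b.2 i + 2 * n := fun i => by
    obtain ⟨n, hn⟩ := (ZMod.intCast_eq_intCast_iff_dvd_sub _ _ 2).1
      (congrFun (congrArg Prod.snd h) i).symm
    exact ⟨n, by push_cast at hn; linarith⟩
  choose n hn using h1
  choose n' hn' using h2
  exact ⟨(n, n'), Prod.ext (funext fun i => by simp [hn]) (funext fun i => by simp [hn'])⟩

theorem riemannTheta_zero_of_arfVec {g : ℕ} {m : ThetaChar g} (τ : Matrix (Fin g) (Fin g) ℂ)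
    (h : arfVec (modChar m) = 1) : riemannTheta m τ 0 = 0 :=
  riemannTheta_zero_of_odd m τ (by rw [cast_dotProduct]; exact h)

theorem thetaGrad_of_arfVec {g : ℕ} {m : ThetaChar g} (τ : Matrix (Fin g) (Fin g) ℂ)
    (h : arfVec (modChar m) = 0) (j : Fin g) : thetaGrad m τ j = 0 :=
  thetaGrad_of_even m τ (by rw [cast_dotProduct]; exact h) j

/-- A term of the derivative of Riemann's theta formula. -/
noncomputable def gradTerm {g : ℕ} (h k₁ k₂ k₃ k₄ : ThetaChar g) (τ : Matrix (Fin g) (Fin g) ℂ)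
    (j : Fin g) (b : ThetaChar g) : ℂ :=
  expPiI ((h.1 ⬝ᵥ b.2 : ℤ) : ℂ) * (thetaGrad (k₁ + b) τ j * thetaConst (k₂ + b) τ *
    (thetaConst (k₃ + b) τ * thetaConst (k₄ + b) τ))

theorem RiemannRelated.sum_eq {g : ℕ} {h₁ h₂ h₃ h₄ k₁ k₂ k₃ k₄ : ThetaChar g}
    (hk : RiemannRelated h₁ h₂ h₃ h₄ k₁ k₂ k₃ k₄) : k₁ + k₂ + k₃ + k₄ = 2 • h₁ := by
  have h : 2 • (k₁ + k₂ + k₃ + k₄) = 2 • (2 • h₁) := by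
    simp only [smul_add, hk.one, hk.two, hk.three, hk.four]
    abel
  refine Prod.ext (funext fun i => ?_) (funext fun i => ?_)
  · have := congrFun (congrArg Prod.fst h) i
    simp only [two_nsmul, Prod.fst_add, Pi.add_apply] at this ⊢
    linarith
  · have := congrFun (congrArg Prod.snd h) i
    simp only [two_nsmul, Prod.snd_add, Pi.add_apply] at this ⊢
    linarith

/-- The four theta factors contribute signs whose product is trivial because `k₁ + k₂ + k₃ + k₄ +
4b` is even. Hence the `{0, 1}`-lift of an index may be replaced by any integral lift, such as a
difference of two characteristics. -/
theorem gradTerm_congr {g : ℕ} {h₁ h₂ h₃ h₄ k₁ k₂ k₃ k₄ : ThetaChar g}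
    (hk : RiemannRelated h₁ h₂ h₃ h₄ k₁ k₂ k₃ k₄) (τ : Matrix (Fin g) (Fin g) ℂ) (j : Fin g)
    {a b : ThetaChar g} (hab : modChar a = modChar b) :
    gradTerm h₁ k₁ k₂ k₃ k₄ τ j a = gradTerm h₁ k₁ k₂ k₃ k₄ τ j b := by
  obtain ⟨n, rfl⟩ := eq_add_two_mul_of_modChar_eq hab
  simp only [gradTerm, ← add_assoc, thetaGrad_add_two_mul, thetaConst_add_two_mul]
  have h1 : expPiI ((h₁.1 ⬝ᵥ (b + 2 • n).2 : ℤ) : ℂ) = expPiI ((h₁.1 ⬝ᵥ b.2 : ℤ) : ℂ) := by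
    rw [← expPiI_int_add_two_mul (h₁.1 ⬝ᵥ b.2) (h₁.1 ⬝ᵥ n.2)]
    congr 2
    simp only [two_nsmul, Prod.snd_add, dotProduct_add]
    ring
  have h2 : expPiI (((k₁ + b).1 ⬝ᵥ n.2 : ℤ) : ℂ) * expPiI (((k₂ + b).1 ⬝ᵥ n.2 : ℤ) : ℂ) *
      (expPiI (((k₃ + b).1 ⬝ᵥ n.2 : ℤ) : ℂ) * expPiI (((k₄ + b).1 ⬝ᵥ n.2 : ℤ) : ℂ)) = 1 := by
    rw [← expPiI_add, ← expPiI_add, ← expPiI_add, ← expPiI_two_mul_int ((h₁ + 2 • b).1 ⬝ᵥ n.2)]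
    congr 1
    have e := congrArg (fun k : ThetaChar g => k.1 ⬝ᵥ n.2) hk.sum_eq
    simp only [two_nsmul, Prod.fst_add, add_dotProduct] at e ⊢
    have e' := congrArg (Int.cast : ℤ → ℂ) e
    push_cast at e' ⊢
    linear_combination e'
  rw [h1]
  linear_combination (expPiI ((h₁.1 ⬝ᵥ b.2 : ℤ) : ℂ) * (thetaGrad (k₁ + b) τ j *
    thetaConst (k₂ + b) τ * (thetaConst (k₃ + b) τ * thetaConst (k₄ + b) τ))) * h2

/-- The derivative at `0` of Riemann's theta formula, when two of the four factors on one side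
vanish there. -/
theorem sum_gradTerm_eq_zero {g : ℕ} {τ : Matrix (Fin g) (Fin g) ℂ}
    (hτ : τ ∈ siegelUpperHalfSpace g) {h₁ h₂ h₃ h₄ k₁ k₂ k₃ k₄ : ThetaChar g}
    (hk : RiemannRelated h₁ h₂ h₃ h₄ k₁ k₂ k₃ k₄) (o₃ : arfVec (modChar h₃) = 1)
    (o₄ : arfVec (modChar h₄) = 1) (j : Fin g) :
    ∑ a : SympSpace g, gradTerm h₁ k₁ k₂ k₃ k₄ τ j (liftChar a) = 0 := by
  -- Only the first argument on the summed side varies, so only its factor is differentiated. On the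
  -- other side all four arguments become `t/2`, and two factors vanish at `t = 0`.
  have hx : ∀ t : ℂ, RiemannRelated (Pi.single j (t / 2) : Fin g → ℂ) (Pi.single j (t / 2))
      (Pi.single j (t / 2)) (Pi.single j (t / 2)) (Pi.single j t) 0 0 0 := fun t => by
    constructor
    · funext i
      by_cases hi : i = j
      · subst hi
        simp
        ring
      · simp [hi]
    all_goals abel
  have hL : HasDerivAt (fun t : ℂ => ∑ a : SympSpace g,
      expPiI ((h₁.1 ⬝ᵥ (liftChar a).2 : ℤ) : ℂ) *
        (riemannTheta (k₁ + liftChar a) τ (Pi.single j t) * riemannTheta (k₂ + liftChar a) τ 0 *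
        (riemannTheta (k₃ + liftChar a) τ 0 * riemannTheta (k₄ + liftChar a) τ 0)))
      (∑ a : SympSpace g, gradTerm h₁ k₁ k₂ k₃ k₄ τ j (liftChar a)) 0 := by
    refine HasDerivAt.fun_sum fun a _ => ?_
    have := (differentiableAt_riemannTheta_single (k₁ + liftChar a) hτ j).hasDerivAt
    exact ((this.mul_const _).mul_const _).const_mul _
  have hd : ∀ h : ThetaChar g, ∃ d : ℂ,
      HasDerivAt (fun t : ℂ => riemannTheta h τ (Pi.single j (t / 2))) d 0 := fun h => by
    have h1 : DifferentiableAt ℂ (fun t : ℂ => riemannTheta h τ (Pi.single j t)) (0 / 2) := by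
      rw [zero_div]
      exact differentiableAt_riemannTheta_single h hτ j
    exact ⟨_, (h1.fun_comp' (0 : ℂ) (differentiableAt_id.div_const (2 : ℂ))).hasDerivAt⟩
  have hR : HasDerivAt (fun t : ℂ => 2 ^ g * (riemannTheta h₁ τ (Pi.single j (t / 2)) *
      riemannTheta h₂ τ (Pi.single j (t / 2)) * (riemannTheta h₃ τ (Pi.single j (t / 2)) *
      riemannTheta h₄ τ (Pi.single j (t / 2))))) 0 0 := by
    obtain ⟨d₁, hd₁⟩ := hd h₁
    obtain ⟨d₂, hd₂⟩ := hd h₂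
    obtain ⟨d₃, hd₃⟩ := hd h₃
    obtain ⟨d₄, hd₄⟩ := hd h₄
    refine (((hd₁.fun_mul hd₂).fun_mul (hd₃.fun_mul hd₄)).const_mul (2 ^ g)).congr_deriv ?_
    simp [riemannTheta_zero_of_arfVec τ o₃, riemannTheta_zero_of_arfVec τ o₄]
  refine hL.unique (hR.congr_of_eventuallyEq (Filter.Eventually.of_forall fun t => ?_))
  exact riemann_theta_formula hτ hk (hx t)

/-- `T` sends `(c, c, c, c)` to `(2c, 0, 0, 0)`. -/
theorem RiemannRelated.shift {M : Type*} [AddCommGroup M] {h₁ h₂ h₃ h₄ k₁ k₂ k₃ k₄ : M}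
    (hk : RiemannRelated h₁ h₂ h₃ h₄ k₁ k₂ k₃ k₄) (c : M) :
    RiemannRelated (h₁ + c) (h₂ + c) (h₃ + c) (h₄ + c) (k₁ + 2 • c) k₂ k₃ k₄ := by
  constructor
  · rw [smul_add, hk.one]; abel
  · rw [hk.two]; abel
  · rw [hk.three]; abel
  · rw [hk.four]; abel

/-- The change of `h` contributes `c'·b''` to the exponent and the even shift of `k₁ + b`
contributes `(k₁ + b)'·c''`. The part independent of `b` is absorbed by the prefactor, leaving the
character `(-1)^ω(b,c)`. -/
theorem gradTerm_shift {g : ℕ} (h k₁ k₂ k₃ k₄ c : ThetaChar g) (τ : Matrix (Fin g) (Fin g) ℂ)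
    (j : Fin g) (b : ThetaChar g) :
    expPiI ((k₁.1 ⬝ᵥ c.2 : ℤ) : ℂ) * gradTerm (h + c) (k₁ + 2 • c) k₂ k₃ k₄ τ j b =
      (if sympForm (modChar b) (modChar c) = 0 then 1 else -1) * gradTerm h k₁ k₂ k₃ k₄ τ j b := by
  have e1 : k₁ + 2 • c + b = k₁ + b + 2 • c := by abel
  have hs : (if sympForm (modChar b) (modChar c) = 0 then (1 : ℂ) else -1) =
      expPiI ((b.1 ⬝ᵥ c.2 + c.1 ⬝ᵥ b.2 : ℤ) : ℂ) := by
    have hc : ((b.1 ⬝ᵥ c.2 + c.1 ⬝ᵥ b.2 : ℤ) : ZMod 2) = sympForm (modChar b) (modChar c) := by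
      rw [Int.cast_add, cast_dotProduct, cast_dotProduct, sympForm, add_comm,
        add_comm (_ ⬝ᵥ _)]
    split_ifs with h0
    · rw [expPiI_int_of_zero (hc.trans h0)]
    · rw [expPiI_int_of_one (hc.trans (ZMod.two_eq_one_of_ne_zero _ h0))]
  have h1 : expPiI ((k₁.1 ⬝ᵥ c.2 : ℤ) : ℂ) * expPiI (((h + c).1 ⬝ᵥ b.2 : ℤ) : ℂ) *
      expPiI (((k₁ + b).1 ⬝ᵥ c.2 : ℤ) : ℂ) =
      expPiI ((b.1 ⬝ᵥ c.2 + c.1 ⬝ᵥ b.2 : ℤ) : ℂ) * expPiI ((h.1 ⬝ᵥ b.2 : ℤ) : ℂ) := by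
    rw [← expPiI_add, ← expPiI_add, ← expPiI_add, ← Int.cast_add, ← Int.cast_add, ← Int.cast_add,
      ← expPiI_int_add_two_mul (_ + h.1 ⬝ᵥ b.2) (k₁.1 ⬝ᵥ c.2)]
    congr 2
    simp only [Prod.fst_add, add_dotProduct]
    ring
  rw [hs, gradTerm, gradTerm, e1, thetaGrad_add_two_mul]
  linear_combination (thetaGrad (k₁ + b) τ j * thetaConst (k₂ + b) τ *
    (thetaConst (k₃ + b) τ * thetaConst (k₄ + b) τ)) * h1

/-- Two instances of the derivative of Riemann's theta formula combine to a relation supported on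
the orthogonal complement of `c`. -/
theorem sum_gradTerm_orthogonal_eq_zero {g : ℕ} {τ : Matrix (Fin g) (Fin g) ℂ}
    (hτ : τ ∈ siegelUpperHalfSpace g) {h₁ h₂ h₃ h₄ k₁ k₂ k₃ k₄ c : ThetaChar g}
    (hk : RiemannRelated h₁ h₂ h₃ h₄ k₁ k₂ k₃ k₄) (o₃ : arfVec (modChar h₃) = 1)
    (o₄ : arfVec (modChar h₄) = 1) (o₃' : arfVec (modChar h₃ + modChar c) = 1)
    (o₄' : arfVec (modChar h₄ + modChar c) = 1) (j : Fin g) :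
    ∑ a : SympSpace g with sympForm a (modChar c) = 0,
      gradTerm h₁ k₁ k₂ k₃ k₄ τ j (liftChar a) = 0 := by
  have s1 := sum_gradTerm_eq_zero hτ hk o₃ o₄ j
  have s2 := sum_gradTerm_eq_zero hτ (hk.shift c) (by rwa [modChar_add]) (by rwa [modChar_add]) j
  have s3 := congrArg (expPiI ((k₁.1 ⬝ᵥ c.2 : ℤ) : ℂ) * ·) s2
  simp only [Finset.mul_sum, gradTerm_shift, mul_zero, modChar_liftChar] at s3
  have s4 := congrArg₂ (· + ·) s1 s3
  simp only [← Finset.sum_add_distrib, add_zero] at s4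
  have s5 : ∑ a : SympSpace g, (if sympForm a (modChar c) = 0 then
      gradTerm h₁ k₁ k₂ k₃ k₄ τ j (liftChar a) else 0) = 0 := by
    have : ∀ a : SympSpace g, gradTerm h₁ k₁ k₂ k₃ k₄ τ j (liftChar a) +
        (if sympForm a (modChar c) = 0 then 1 else -1) *
          gradTerm h₁ k₁ k₂ k₃ k₄ τ j (liftChar a) =
        2 * (if sympForm a (modChar c) = 0 then
          gradTerm h₁ k₁ k₂ k₃ k₄ τ j (liftChar a) else 0) := fun a => by
      split_ifs <;> ring
    simp only [this, ← Finset.mul_sum] at s4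
    simpa using s4
  rwa [Finset.sum_filter]

/-! ### The four-gradient relation and the Jacobian identity. -/

theorem IsAronhold.isAzygeticBasis {q₁ q₂ q₃ q₄ q₅ q₆ q₇ : SympQuadForm 3}
    (h : IsAronhold ![q₁, q₂, q₃, q₄, q₅, q₆, q₇]) :
    IsAzygeticBasis (formCoords q₁.1)
      fun i => formCoords q₁.1 + formCoords ((![q₂, q₃, q₄, q₅, q₆, q₇] : Fin 6 → _) i).1 :=
  (isAronhold_iff (h.1 0) _).1 h

/-- If a term of the relation does not vanish, its gradient has an odd characteristic and its theta
constants have even ones. -/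
theorem arfVec_of_gradTerm_ne_zero {g : ℕ} {h k₁ k₂ k₃ k₄ : ThetaChar g}
    {τ : Matrix (Fin g) (Fin g) ℂ} {j : Fin g} {b : ThetaChar g}
    (hne : gradTerm h k₁ k₂ k₃ k₄ τ j b ≠ 0) :
    arfVec (modChar k₁ + modChar b) = 1 ∧ arfVec (modChar k₂ + modChar b) = 0 ∧
      arfVec (modChar k₃ + modChar b) = 0 ∧ arfVec (modChar k₄ + modChar b) = 0 := by
  simp only [gradTerm, mul_ne_zero_iff] at hne
  obtain ⟨-, ⟨n1, n2⟩, n3, n4⟩ := hne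
  simp only [← modChar_add]
  have even : ∀ x : ZMod 2, x ≠ 1 → x = 0 := by decide
  exact ⟨ZMod.two_eq_one_of_ne_zero _ fun e => n1 (thetaGrad_of_arfVec τ e j),
    even _ fun e => n2 (riemannTheta_zero_of_arfVec τ e),
    even _ fun e => n3 (riemannTheta_zero_of_arfVec τ e),
    even _ fun e => n4 (riemannTheta_zero_of_arfVec τ e)⟩

/-- Evenness of the characteristic of a theta constant is turned into a linear condition: it says
that `arfDiff m` is `1` at `(m+a) + (m+b) + x`, and expanding leaves only the two products with `x`.
-/
theorem sympForm_eq_of_arfVec {g : ℕ} {m a b x : SympSpace g} (hm : arfVec m = 1)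
    (ha : arfDiff m (m + a) = 0) (hb : arfDiff m (m + b) = 0)
    (hab : sympForm (m + a) (m + b) = 1) (hx : arfDiff m x = 0) (h : arfVec (a + b + m + x) = 0) :
    sympForm x (m + a) = sympForm x (m + b) := by
  have e : arfDiff m ((m + a) + (m + b) + x) = 1 := by
    have : m + ((m + a) + (m + b) + x) = (m + m) + (a + b + m + x) := by abel
    rw [arfDiff, this, sympSpace_add_self, zero_add, h, hm, zero_add]
  rw [arfDiff_add, arfDiff_add, ha, hb, hab, hx] at e
  rw [sympForm_add_left (m + a), sympForm_comm (m + a) x, sympForm_comm (m + b) x] at e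
  generalize sympForm x (m + a) = s at *
  generalize sympForm x (m + b) = t at *
  grind

/-- The linear relation between the gradients of four members of an Aronhold system. -/
theorem IsAronhold.thetaGrad_relation {q₁ q₂ q₃ q₄ q₅ q₆ q₇ : SympQuadForm 3}
    (h : IsAronhold ![q₁, q₂, q₃, q₄, q₅, q₆, q₇]) {τ : Matrix (Fin 3) (Fin 3) ℂ}
    (hτ : τ ∈ siegelUpperHalfSpace 3) (j : Fin 3) :
    ∑ i : Fin 4, expPiI (((q₅.char + q₆.char + q₇.char).1 ⬝ᵥ
        (q₁.char + (![q₁, q₂, q₃, q₄] i).char).2 : ℤ) : ℂ) *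
      (thetaGrad (![q₁, q₂, q₃, q₄] i).char τ j *
        thetaConst (q₅.char + q₆.char + (![q₁, q₂, q₃, q₄] i).char) τ *
        (thetaConst (q₅.char + q₇.char + (![q₁, q₂, q₃, q₄] i).char) τ *
          thetaConst (q₆.char + q₇.char + (![q₁, q₂, q₃, q₄] i).char) τ)) = 0 := by
  have hu := h.isAzygeticBasis
  have hm : arfVec (formCoords q₁.1) = 1 := h.1 0
  obtain ⟨c, hc⟩ : ∃ c, c = q₁.char + q₂.char + q₃.char + q₄.char := ⟨_, rfl⟩
  have hk : RiemannRelated (2 • q₁.char + (q₅.char + q₆.char + q₇.char)) (-q₇.char) (-q₆.char)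
      (-q₅.char) q₁.char (q₅.char + q₆.char + q₁.char) (q₅.char + q₇.char + q₁.char)
      (q₆.char + q₇.char + q₁.char) := by
    constructor <;> abel
  obtain ⟨u, hudef⟩ : ∃ u : Fin 6 → SympSpace 3, u = fun i => formCoords q₁.1 +
    formCoords ((![q₂, q₃, q₄, q₅, q₆, q₇] : Fin 6 → _) i).1 := ⟨_, rfl⟩
  rw [← hudef] at hu
  have u0 : u 0 = formCoords q₁.1 + formCoords q₂.1 := by rw [hudef]; rfl
  have u1 : u 1 = formCoords q₁.1 + formCoords q₃.1 := by rw [hudef]; rfl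
  have u2 : u 2 = formCoords q₁.1 + formCoords q₄.1 := by rw [hudef]; rfl
  have u3 : u 3 = formCoords q₁.1 + formCoords q₅.1 := by rw [hudef]; rfl
  have u4 : u 4 = formCoords q₁.1 + formCoords q₆.1 := by rw [hudef]; rfl
  have u5 : u 5 = formCoords q₁.1 + formCoords q₇.1 := by rw [hudef]; rfl
  have hcu : modChar c = u 0 + u 1 + u 2 := by
    simp only [hc, modChar_add, modChar_char, u0, u1, u2]
    have : ∀ a b c d : SympSpace 3, a + b + (a + c) + (a + d) = (a + a) + (a + b + c + d) := by
      intros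
      abel
    rw [this, sympSpace_add_self, zero_add]
  -- For `q₅` and `q₆`, the form `q + c` belongs to the other completion of `q₁, …, q₄`, hence is
  -- odd.
  have hoc : ∀ (q : SympQuadForm 3) (i l : Fin 6), u i = formCoords q₁.1 + formCoords q.1 →
      (![u 3, u 4, u 5, u 3 + (u 0 + u 1 + u 2), u 4 + (u 0 + u 1 + u 2),
        u 5 + (u 0 + u 1 + u 2)] : Fin 6 → _) l = u i + (u 0 + u 1 + u 2) →
      arfVec (modChar (-q.char) + modChar c) = 1 := by
    intro q i l hi hl
    have := hu.arfDiff_completing l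
    rw [hl, hi, ← hcu, add_assoc, arfDiff_add_eq_zero_iff hm] at this
    rw [modChar_neg, modChar_char, this]
  have hrel := sum_gradTerm_orthogonal_eq_zero hτ hk (c := c)
    (by rw [modChar_neg, modChar_char]; exact h.1 5)
    (by rw [modChar_neg, modChar_char]; exact h.1 4) (hoc q₆ 4 4 u4 rfl) (hoc q₅ 3 3 u3 rfl) j
  rw [hcu] at hrel
  have hone := hu.one
  have hsub : ({0, u 0, u 1, u 2} : Finset (SympSpace 3)) ⊆
      Finset.univ.filter fun a => sympForm a (u 0 + u 1 + u 2) = 0 := by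
    intro a ha
    simp only [Finset.mem_insert, Finset.mem_singleton] at ha
    rw [Finset.mem_filter]
    refine ⟨Finset.mem_univ _, ?_⟩
    rcases ha with rfl | rfl | rfl | rfl
    · simp
    · rw [sympForm_add_right, sympForm_add_right, sympForm_self, hone 0 1 (by decide),
        hone 0 2 (by decide)]
      rfl
    · rw [sympForm_add_right, sympForm_add_right, sympForm_self, hone 1 0 (by decide),
        hone 1 2 (by decide)]
      rfl
    · rw [sympForm_add_right, sympForm_add_right, sympForm_self, hone 2 0 (by decide),
        hone 2 1 (by decide)]
      rfl
  rw [← Finset.sum_subset hsub] at hrel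
  · have hne0 : ∀ i, u i ≠ 0 := fun i h0 => by
      obtain ⟨l, hl⟩ := exists_ne i
      have := hone l i hl
      rw [h0] at this
      simp at this
    have hne : ∀ i l, i ≠ l → u i ≠ u l := fun i l hil he => by
      have := hone i l hil
      rw [he] at this
      simp at this
    -- Using the integral lift `q - q₁` of the index makes the characteristics exactly those of the
    -- relation, so the sign needs correction only by an even exponent.
    have hval : ∀ (a : SympSpace 3) (q : SympQuadForm 3), a = formCoords q₁.1 + formCoords q.1 →
        gradTerm (2 • q₁.char + (q₅.char + q₆.char + q₇.char)) q₁.char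
          (q₅.char + q₆.char + q₁.char) (q₅.char + q₇.char + q₁.char)
          (q₆.char + q₇.char + q₁.char) τ j (liftChar a) =
        expPiI (((q₅.char + q₆.char + q₇.char).1 ⬝ᵥ (q₁.char + q.char).2 : ℤ) : ℂ) *
          (thetaGrad q.char τ j * thetaConst (q₅.char + q₆.char + q.char) τ *
            (thetaConst (q₅.char + q₇.char + q.char) τ *
              thetaConst (q₆.char + q₇.char + q.char) τ)) := by
      intro a q ha
      rw [gradTerm_congr hk τ j (b := q.char - q₁.char), gradTerm]
      · have e1 : q₁.char + (q.char - q₁.char) = q.char := by abel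
        have e2 : ∀ x : ThetaChar 3, x + q₁.char + (q.char - q₁.char) = x + q.char := fun x => by
          abel
        rw [e1, e2, e2, e2, ← expPiI_int_add_two_mul
          ((q₅.char + q₆.char + q₇.char).1 ⬝ᵥ (q₁.char + q.char).2)
          (q₁.char.1 ⬝ᵥ (q.char - q₁.char).2 -
            (q₅.char + q₆.char + q₇.char).1 ⬝ᵥ q₁.char.2)]
        congr 3
        simp only [two_nsmul, Prod.fst_add, Prod.snd_add, Prod.snd_sub, add_dotProduct,
          dotProduct_add, dotProduct_sub]
        ring
      · rw [modChar_liftChar, ha, modChar_sub, modChar_char, modChar_char, add_comm]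
    rw [Finset.sum_insert, Finset.sum_insert, Finset.sum_insert, Finset.sum_singleton,
      hval 0 q₁ (sympSpace_add_self _).symm, hval _ q₂ u0, hval _ q₃ u1, hval _ q₄ u2] at hrel
    · rw [Fin.sum_univ_four, ← hrel]
      simp only [cons_val]
      ring
    · simpa using hne 1 2 (by decide)
    · simpa using ⟨hne 0 1 (by decide), hne 0 2 (by decide)⟩
    · simpa using ⟨(hne0 0).symm, (hne0 1).symm, (hne0 2).symm⟩
  -- A nonzero term outside the four would have `q₁ + x` odd, `x ⊥ c` and equal products with `u₃,
  -- u₄, u₅`, which is excluded by `IsAzygeticBasis.eq_of_orthogonal`.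
  · intro x hx hx'
    by_contra hne
    obtain ⟨x1, x2, x3, x4⟩ := arfVec_of_gradTerm_ne_zero hne
    simp only [modChar_add, modChar_char, modChar_liftChar] at x1 x2 x3 x4
    have hx0 : arfDiff (formCoords q₁.1) x = 0 := by
      rw [arfDiff, x1, hm]
      rfl
    have e34 := sympForm_eq_of_arfVec hm (u3 ▸ hu.zero 3) (u4 ▸ hu.zero 4)
      (u3 ▸ u4 ▸ hone 3 4 (by decide)) hx0 x2
    have e45 := sympForm_eq_of_arfVec hm (u4 ▸ hu.zero 4) (u5 ▸ hu.zero 5)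
      (u4 ▸ u5 ▸ hone 4 5 (by decide)) hx0 x4
    rw [← u3, ← u4] at e34
    rw [← u4, ← u5] at e45
    refine hx' ?_
    simp only [Finset.mem_insert, Finset.mem_singleton]
    exact hu.eq_of_orthogonal hx0 (Finset.mem_filter.1 hx).2 e34 e45

theorem IsAronhold.thetaJac_mul {q₁ q₂ q₃ q₄ q₅ q₆ q₇ : SympQuadForm 3}
    (h : IsAronhold ![q₁, q₂, q₃, q₄, q₅, q₆, q₇]) {τ : Matrix (Fin 3) (Fin 3) ℂ}
    (hτ : τ ∈ siegelUpperHalfSpace 3) :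
    thetaJac ![q₄, q₂, q₃] τ *
        (thetaConst (q₅.char + q₆.char + q₄.char) τ *
          thetaConst (q₅.char + q₇.char + q₄.char) τ *
          thetaConst (q₆.char + q₇.char + q₄.char) τ) =
      -expPiI (((q₅.char + q₆.char + q₇.char).1 ⬝ᵥ (q₁.char + q₄.char).2 : ℤ) : ℂ) *
        thetaJac ![q₁, q₂, q₃] τ *
        (thetaConst (q₅.char + q₆.char + q₁.char) τ *
          thetaConst (q₅.char + q₇.char + q₁.char) τ *
          thetaConst (q₆.char + q₇.char + q₁.char) τ) := by
  have hrel := h.thetaGrad_relation hτ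
  simp only [Fin.sum_univ_four, cons_val] at hrel
  have r0 := hrel 0
  have r1 := hrel 1
  have r2 := hrel 2
  have e1 : expPiI (((q₅.char + q₆.char + q₇.char).1 ⬝ᵥ (q₁.char + q₁.char).2 : ℤ) : ℂ) = 1 := by
    rw [Prod.snd_add, dotProduct_add, ← two_mul, Int.cast_mul]
    exact expPiI_two_mul_int _
  have e4 : ∀ n : ℤ, expPiI (n : ℂ) * expPiI (n : ℂ) = 1 := fun n => by
    rw [← expPiI_add, ← two_mul, expPiI_two_mul_int]
  have e4' := e4 ((q₅.char + q₆.char + q₇.char).1 ⬝ᵥ (q₁.char + q₄.char).2)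
  rw [e1] at r0 r1 r2
  simp only [thetaJac, det_fin_three, of_apply, cons_val]
  generalize expPiI (((q₅.char + q₆.char + q₇.char).1 ⬝ᵥ (q₁.char + q₄.char).2 : ℤ) : ℂ) = ε at *
  generalize expPiI (((q₅.char + q₆.char + q₇.char).1 ⬝ᵥ (q₁.char + q₂.char).2 : ℤ) : ℂ) = ε₂ at *
  generalize expPiI (((q₅.char + q₆.char + q₇.char).1 ⬝ᵥ (q₁.char + q₃.char).2 : ℤ) : ℂ) = ε₃ at *
  generalize thetaConst (q₅.char + q₆.char + q₁.char) τ = a₁ at *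
  generalize thetaConst (q₅.char + q₇.char + q₁.char) τ = a₂ at *
  generalize thetaConst (q₆.char + q₇.char + q₁.char) τ = a₃ at *
  generalize thetaConst (q₅.char + q₆.char + q₄.char) τ = b₁ at *
  generalize thetaConst (q₅.char + q₇.char + q₄.char) τ = b₂ at *
  generalize thetaConst (q₆.char + q₇.char + q₄.char) τ = b₃ at *
  generalize thetaGrad q₁.char τ = d₁ at *
  generalize thetaGrad q₂.char τ = d₂ at *
  generalize thetaGrad q₃.char τ = d₃ at *
  generalize thetaGrad q₄.char τ = d₄ at *
  -- The relation is paired with the cross product `d₂ × d₃`, which kills the terms of `q₂` and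
  -- `q₃`. Multiplication by `ε`, with `ε² = 1`, moves the sign to the other side.
  linear_combination ε * (d₂ 1 * d₃ 2 - d₂ 2 * d₃ 1) * r0 + ε * (d₂ 2 * d₃ 0 - d₂ 0 * d₃ 2) * r1 +
    ε * (d₂ 0 * d₃ 1 - d₂ 1 * d₃ 0) * r2 -
    (d₄ 0 * (d₂ 1 * d₃ 2 - d₂ 2 * d₃ 1) + d₄ 1 * (d₂ 2 * d₃ 0 - d₂ 0 * d₃ 2) +
      d₄ 2 * (d₂ 0 * d₃ 1 - d₂ 1 * d₃ 0)) * (b₁ * b₂ * b₃) * e4'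

theorem mainTheorem2 (q₁ q₂ q₃ q₄ : SympQuadForm 3)
    (h₁ : IsOddForm q₁) (h₂ : IsOddForm q₂) (h₃ : IsOddForm q₃) (h₄ : IsOddForm q₄)
    (hazy : IsAzygetic ![q₁, q₂, q₃, q₄]) :
    {T : Set (SympQuadForm 3) | ∃ q₅ q₆ q₇, T = {q₅, q₆, q₇} ∧
        IsAronhold ![q₁, q₂, q₃, q₄, q₅, q₆, q₇]}.ncard = 2 ∧
    ∀ q₅ q₆ q₇ : SympQuadForm 3, IsAronhold ![q₁, q₂, q₃, q₄, q₅, q₆, q₇] →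
      ∀ τ ∈ siegelUpperHalfSpace 3,
        (thetaJac ![q₄, q₂, q₃] τ *
            (thetaConst (q₅.char + q₆.char + q₄.char) τ *
              thetaConst (q₅.char + q₇.char + q₄.char) τ *
              thetaConst (q₆.char + q₇.char + q₄.char) τ) =
          -expPiI (((q₅.char + q₆.char + q₇.char).1 ⬝ᵥ (q₁.char + q₄.char).2 : ℤ) : ℂ) *
            thetaJac ![q₁, q₂, q₃] τ *
            (thetaConst (q₅.char + q₆.char + q₁.char) τ *
              thetaConst (q₅.char + q₇.char + q₁.char) τ *
              thetaConst (q₆.char + q₇.char + q₁.char) τ)) ∧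
        (thetaJac ![q₁, q₂, q₃] τ ≠ 0 →
          thetaConst (q₅.char + q₆.char + q₄.char) τ ≠ 0 →
          thetaConst (q₅.char + q₇.char + q₄.char) τ ≠ 0 →
          thetaConst (q₆.char + q₇.char + q₄.char) τ ≠ 0 →
          thetaJac ![q₄, q₂, q₃] τ / thetaJac ![q₁, q₂, q₃] τ =
            -expPiI (((q₅.char + q₆.char + q₇.char).1 ⬝ᵥ (q₁.char + q₄.char).2 : ℤ) : ℂ) *
              ((thetaConst (q₅.char + q₆.char + q₁.char) τ *
                  thetaConst (q₅.char + q₇.char + q₁.char) τ *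
                  thetaConst (q₆.char + q₇.char + q₁.char) τ) /
                (thetaConst (q₅.char + q₆.char + q₄.char) τ *
                  thetaConst (q₅.char + q₇.char + q₄.char) τ *
                  thetaConst (q₆.char + q₇.char + q₄.char) τ))) := by
  refine ⟨ncard_completions h₁ h₂ h₃ h₄ hazy, fun q₅ q₆ q₇ hA τ hτ => ?_⟩
  have key := hA.thetaJac_mul hτ
  refine ⟨key, fun hD t₁ t₂ t₃ => ?_⟩
  rw [← mul_div_assoc, div_eq_div_iff hD (mul_ne_zero (mul_ne_zero t₁ t₂) t₃), key]
  ring
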